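/- Let $d\in\{2,3\}$, let $K\subset\mathbb{R}^d$ be a compact convex reference cell with nonempty interior (e.g. a simplex or a cube), and fix two Lagrange elements on $K$, one for the director and one for the multiplier: each consists of finitely many nodes in $K$ and polynomial shape functions that are dual to the nodal values and whose span contains the constants. Let $0<\alpha\le 1\le\beta$ and $L\in\mathbb{R}$. Then there is a constant $C>0$, depending only on these data, such that the following holds. Let $\Omega\subset\mathbb{R}^d$ be a bounded open set that is the interior of its closure (e.g. a bounded Lipschitz domain), and let $\mathbf n_k:\Omega\to\mathbb{R}^3$ be weakly differentiable with $\alpha\le|\mathbf n_k|^2\le\beta$ and $|\nabla\mathbf n_k|\le L$ a.e. in $\Omega$. Consider a mesh of $\Omega$, i.e. finitely many affine images of $K$ with pairwise disjoint interiors whose union is $\overline\Omega$, and let $h$ be the largest diameter of a cell. Let $Q_h\subset L^2(\Omega)$ be the finite element space of the multiplier element, spanned by its nodal basis functions $\chi_1,\dots,\chi_m$ (one per global node, where nodes of different cells that coincide as points are identified; the restriction of a basis function to a cell is the transported shape function of its node, or $0$ if the node does not belong to the cell). Let $V_h=\mathrm{span}\{\phi_1,\dots,\phi_N\}$, where $\phi_1,\dots,\phi_N$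 are the scalar nodal basis functions of the director element at the nodes inside $\Omega$, multiplied by the unit vectors of $\mathbb{R}^3$; assume that $V_h$ is conforming, $V_h\subset H^1_0(\Omega;\mathbb{R}^3)$, in the sense that its functions are continuous on $\overline\Omega$ and vanish on $\partial\Omega$. Define the matrices $$(A_*)_{ij}=4\int_\Omega(\mathbf n_k\cdot\phi_j)(\mathbf n_k\cdot\phi_i)\,dx,\qquad B_{ji}=\int_\Omega \chi_j\,(2\,\mathbf n_k\cdot\phi_i)\,dx,\qquad (M_\lambda)_{ij}=\int_\Omega\chi_i\chi_j\,dx .$$ Then for every $\delta\mathbf n_h=\sum_i U_i\phi_i\in V_h$ (in particular for the director component of a solution $(\delta\mathbf n_h,\delta\lambda_h)\in V_h\times Q_h$ of the augmented discrete linearized system at $(\mathbf n_k,\lambda_k)$) $$\left\|\left(A_*-B^\top M_\lambda^{-1}B\right)U\right\|_{\mathbb{R}^N}\le C\,h^{1+\frac d2}\,\|\delta\mathbf n_h\|_1,$$ where $\|\cdot\|_{\mathbb{R}^N}$ is the Euclidean norm and $\|v\|_1^2=\|v\|_0^2+\|\nabla v\|_0^2$ is the squared $H^1(\Omega)$ norm.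 Consequently, along any sequence of such meshes of $\Omega$ with $h\to0$ and any $\delta\mathbf n_h\in V_h$ with $\|\delta\mathbf n_h\|_1$ bounded, $\|(A_*-B^\top M_\lambda^{-1}B)U\|_{\mathbb{R}^N}\to0$. -/

import Mathlib

open MeasureTheory Filter Topology
open scoped ENNReal NNReal ContDiff Matrix

noncomputable section

namespace OseenFrank

/-- Physical space `ℝᵈ` with the Euclidean norm. -/
abbrev Pt (d : ℕ) := EuclideanSpace ℝ (Fin d)

/-- Directors take values in `ℝ³`, also when `d = 2`. -/
abbrev Dir := EuclideanSpace ℝ (Fin 3)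

/-- A Lagrange finite element on the reference cell `K`: nodes in `K` and polynomial shape
functions dual to the nodal values, whose span `P̂` contains the constants
(equivalently, the shape functions sum to one). Elements such as `ℙ_k` on a simplex, `ℚ_k` on a
cube or bubble-enriched elements are of this form; discontinuous elements are obtained by
placing the nodes in the interior of `K`. -/
structure LagrangeElement {d : ℕ} (K : Set (Pt d)) where
  /-- number of nodes -/
  num : ℕ
  /-- the nodes -/
  node : Fin num → Pt d
  node_mem : ∀ a, node a ∈ K
  /-- the shape functions -/
  shape : Fin num → MvPolynomial (Fin d) ℝ
  shape_node : ∀ a b, MvPolynomial.eval (fun l => node b l) (shape a) = if a = b then 1 else 0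
  sum_shape : ∑ a, shape a = 1

/-- A non-overlapping mesh of `Ω` whose cells are affine images of the reference cell `K`. -/
structure AffineMesh {d : ℕ} (K Ω : Set (Pt d)) where
  /-- number of cells -/
  num : ℕ
  /-- the affine bijections from the reference cell onto the cells -/
  map : Fin num → (Pt d ≃ᵃ[ℝ] Pt d)
  cover : ⋃ i, map i '' K = closure Ω
  disjoint : ∀ i j, i ≠ j → Disjoint (interior (map i '' K)) (interior (map j '' K))

namespace AffineMesh

variable {d : ℕ} {K Ω : Set (Pt d)}

/-- The mesh size `h`: the largest diameter of a cell. -/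
def size (T : AffineMesh K Ω) : ℝ := ⨆ i, Metric.diam (T.map i '' K)

open Classical in
/-- The global nodes of a Lagrange element on the mesh. Local nodes of different cells that
coincide as points are identified. -/
def nodes (T : AffineMesh K Ω) (R : LagrangeElement K) : Finset (Pt d) :=
  Finset.univ.image fun p : Fin T.num × Fin R.num => T.map p.1 (R.node p.2)

open Classical in
/-- The global nodes that do not lie on the boundary of `Ω`. -/
def interiorNodes (T : AffineMesh K Ω) (R : LagrangeElement K) : Finset (Pt d) :=
  (T.nodes R).filter (· ∈ Ω)

open Classical in
/-- The restriction to the `i`-th cell of the global basis function attached to the node `x`: the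
transported shape function of `x` if `x` is a node of that cell, and zero otherwise. -/
def localBasisFn (T : AffineMesh K Ω) (R : LagrangeElement K) (x : Pt d) (i : Fin T.num)
    (y : Pt d) : ℝ :=
  ∑ a, if T.map i (R.node a) = x then
    MvPolynomial.eval (fun l => (T.map i).symm y l) (R.shape a) else 0

open Classical in
/-- The global nodal basis function attached to the node `x`. On points shared by several cells
the value is taken from one of them; these points form a null set, and the choice does not matter
when the basis function is continuous. -/
def basisFn (T : AffineMesh K Ω) (R : LagrangeElement K) (x : Pt d) (y : Pt d) : ℝ :=
  if h : ∃ i, y ∈ T.map i '' K then T.localBasisFn R x h.choose y else 0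

/-- Conformity of the director space, `V_h ⊂ H¹₀`: the nodal basis functions of the
nodes inside `Ω` are continuous on `closure Ω` and vanish on the boundary. -/
def IsConforming (T : AffineMesh K Ω) (R : LagrangeElement K) : Prop :=
  ∀ x ∈ T.interiorNodes R, ContinuousOn (T.basisFn R x) (closure Ω) ∧
    ∀ y ∈ frontier Ω, T.basisFn R x y = 0

/-- Degrees of freedom of the director space `V_h`: one for each interior node and each of the
three components. -/
abbrev DirDof (T : AffineMesh K Ω) (R : LagrangeElement K) := ↥(T.interiorNodes R) × Fin 3

/-- Degrees of freedom of the multiplier space `Q_h`: one for each node. -/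
abbrev MulDof (T : AffineMesh K Ω) (R : LagrangeElement K) := ↥(T.nodes R)

/-- The basis functions of `V_h`. -/
def dirBasis (T : AffineMesh K Ω) (R : LagrangeElement K) (k : T.DirDof R) (y : Pt d) : Dir :=
  EuclideanSpace.single k.2 (T.basisFn R k.1 y)

/-- The basis functions of `Q_h`. -/
def mulBasis (T : AffineMesh K Ω) (R : LagrangeElement K) (k : T.MulDof R) (y : Pt d) : ℝ :=
  T.basisFn R k y

/-- The function in `V_h` with coefficient vector `U`. -/
def dirFun (T : AffineMesh K Ω) (R : LagrangeElement K) (U : T.DirDof R → ℝ) (y : Pt d) : Dir :=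
  ∑ k, U k • T.dirBasis R k y

/-- The augmentation matrix `A_*`: the assembly of `4 ⟨n·u, n·v⟩₀`. -/
def augMatrix (T : AffineMesh K Ω) (R : LagrangeElement K) (n : Pt d → Dir) :
    Matrix (T.DirDof R) (T.DirDof R) ℝ :=
  Matrix.of fun k l =>
    4 * ∫ y in Ω, inner ℝ (n y) (T.dirBasis R l y) * inner ℝ (n y) (T.dirBasis R k y)

/-- The constraint matrix `B`: the assembly of `b(v, p) = ⟨p, 2 n·v⟩₀`. -/
def constraintMatrix (T : AffineMesh K Ω) (RV RQ : LagrangeElement K) (n : Pt d → Dir) :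
    Matrix (T.MulDof RQ) (T.DirDof RV) ℝ :=
  Matrix.of fun j k => ∫ y in Ω, T.mulBasis RQ j y * (2 * inner ℝ (n y) (T.dirBasis RV k y))

/-- The mass matrix `M_λ` of the multiplier space. -/
def massMatrix (T : AffineMesh K Ω) (R : LagrangeElement K) :
    Matrix (T.MulDof R) (T.MulDof R) ℝ :=
  Matrix.of fun i j => ∫ y in Ω, T.mulBasis R i y * T.mulBasis R j y

open Classical in
/-- The difference `A_* - Bᵀ M_λ⁻¹ B`. -/
def defectMatrix (T : AffineMesh K Ω) (RV RQ : LagrangeElement K) (n : Pt d → Dir) :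
    Matrix (T.DirDof RV) (T.DirDof RV) ℝ :=
  T.augMatrix RV n -
    (T.constraintMatrix RV RQ n)ᵀ * (T.massMatrix RQ)⁻¹ * T.constraintMatrix RV RQ n

end AffineMesh

/-- `G` is the weak gradient of the vector field `u` on `Ω`: `G (c, l)` is the weak partial
derivative `∂_l u_c`. The norm of `G x` is the Frobenius norm. -/
structure IsWeakGradient {d : ℕ} (Ω : Set (Pt d)) (u : Pt d → Dir)
    (G : Pt d → EuclideanSpace ℝ (Fin 3 × Fin d)) : Prop where
  locallyIntegrable : LocallyIntegrableOn u Ω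
  locallyIntegrable_grad : LocallyIntegrableOn G Ω
  integral_eq : ∀ φ : Pt d → ℝ, ContDiff ℝ ∞ φ → HasCompactSupport φ → tsupport φ ⊆ Ω →
    ∀ (c : Fin 3) (l : Fin d),
      ∫ x in Ω, u x c * fderiv ℝ φ x (EuclideanSpace.single l 1) = -∫ x in Ω, G x (c, l) * φ x

/-- The norm `‖u‖₁ = (‖u‖₀² + ‖∇u‖₀²)^{1/2}` of `H¹(Ω; ℝ³)`; it is `∞` if `u` has no
weak gradient. Weak gradients are unique almost everywhere, so the infimum is over one value. -/
def h1Norm {d : ℕ} (Ω : Set (Pt d)) (u : Pt d → Dir) : ℝ≥0∞ :=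
  ⨅ (G : Pt d → EuclideanSpace ℝ (Fin 3 × Fin d)) (_ : IsWeakGradient Ω u G),
    ((∫⁻ x in Ω, ‖u x‖ₑ ^ 2) + ∫⁻ x in Ω, ‖G x‖ₑ ^ 2) ^ (1 / 2 : ℝ)

end OseenFrank

end

/-! Write `v` for the director function with coefficients `U`, and let `e` be the residual of the
`L²(Ω)` projection of `2 n · v` onto `Q_h`. Since `M_λ` is the Gram matrix of the multiplier basis,
`M_λ⁻¹ B U` holds the coefficients of that projection, and the `k`-th entry of `(A_* - Bᵀ M_λ⁻¹ B)
U` equals `2 ∫ e (n · φ_k)` (`exists_projection_residual`). Two independent estimates then produce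
the two powers of `h`.

The factor `h^(d/2)` comes from testing with basis functions (`sum_sq_integral_le`). Weighted
Cauchy–Schwarz gives `(∫ e n·φ_k)² ≤ β² (∫ e² |φ_k|) (∫ |φ_k|)`. A scalar basis function is bounded
and lives in a ball of radius `h` about its node, so its mass is `O(h^d)`; the absolute values of
the basis functions sum pointwise to at most the Lebesgue constant of the element, so summing over
`k` costs only a constant.

The factor `h` comes from `‖e‖₀ ≤ ‖2 n · v - q‖₀` for every `q` in `Q_h`, applied to a nodal
interpolant (`exists_interpolation_error_le`). On a cell the error splits into `n · (v - v(x))` and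
`(n - m(x)) · v(x)`, with `x` a node and `m(x)` a substitute for `n(x)`. The first part is the
oscillation of `v`, bounded on the reference cell by its gradient through equivalence of norms in
finite dimension. The second is small because a bounded weak gradient makes `n` Lipschitz on convex
open sets, up to a null set (`HasWeakPartials.lipschitz`). At nodes on the boundary `v` vanishes, so
no value of `n` is needed there.

Only upper bounds on the cell maps enter: the Jacobian factors cancel and the pulled-back gradient
involves the linear part, not its inverse. Hence no shape regularity or quasi-uniformity is needed,
and `C` does not depend on `Ω` or the mesh. -/

noncomputable section

namespace OseenFrank

/-! ### Weak derivatives: Lipschitz bounds and agreement with classical derivatives -/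

/-- `g l` is the weak partial derivative `∂_l u` on `D`, tested with smooth functions. -/
def HasWeakPartials {d : ℕ} (D : Set (Pt d)) (u : Pt d → ℝ) (g : Fin d → Pt d → ℝ) : Prop :=
  ∀ φ : Pt d → ℝ, ContDiff ℝ ∞ φ → HasCompactSupport φ → tsupport φ ⊆ D → ∀ l : Fin d,
    ∫ x in D, u x * fderiv ℝ φ x (EuclideanSpace.single l 1) = -∫ x in D, g l x * φ x

theorem opNorm_le_of_single_le {d : ℕ} (f : Pt d →L[ℝ] ℝ) {L : ℝ} (hL : 0 ≤ L)
    (h : ∀ l, |f (EuclideanSpace.single l 1)| ≤ L) : ‖f‖ ≤ d * L := by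
  refine f.opNorm_le_bound (by positivity) fun x => ?_
  have hx : x = ∑ l, x l • EuclideanSpace.single l (1 : ℝ) := by
    ext j
    simp [Finset.sum_apply, Pi.single_apply]
  calc ‖f x‖ = |∑ l, x l * f (EuclideanSpace.single l 1)| := by
        conv_lhs => rw [hx]
        simp [map_sum]
    _ ≤ ∑ l, |x l * f (EuclideanSpace.single l 1)| := Finset.abs_sum_le_sum_abs _ _
    _ ≤ ∑ _l : Fin d, ‖x‖ * L := by
        refine Finset.sum_le_sum fun l _ => ?_
        rw [abs_mul]
        exact mul_le_mul (PiLp.norm_apply_le x l) (h l) (abs_nonneg _) (norm_nonneg _)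
    _ = d * L * ‖x‖ := by simp; ring

theorem abs_setIntegral_mul_le {d : ℕ} {D : Set (Pt d)} {g η : Pt d → ℝ} {L : ℝ}
    (hg : ∀ᵐ x ∂volume.restrict D, |g x| ≤ L) (hη : Integrable η) (hη0 : ∀ x, 0 ≤ η x)
    (hL : 0 ≤ L) (hη1 : ∫ x, η x = 1) : |∫ x in D, g x * η x| ≤ L := by
  calc |∫ x in D, g x * η x| ≤ ∫ x in D, L * η x := by
        rw [← Real.norm_eq_abs]
        refine norm_integral_le_of_norm_le (hη.const_mul L).restrict ?_
        filter_upwards [hg] with x hx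
        rw [Real.norm_eq_abs, abs_mul, abs_of_nonneg (hη0 x)]
        exact mul_le_mul_of_nonneg_right hx (hη0 x)
    _ ≤ ∫ x, L * η x :=
        setIntegral_le_integral (hη.const_mul L)
          (Eventually.of_forall fun x => mul_nonneg hL (hη0 x))
    _ = L := by rw [integral_const_mul, hη1, mul_one]

-- The derivative falls on the mollifier. The reflected, translated bump `t ↦ η (x - t)` is
-- supported in the closed ball inside `D`, hence is an admissible test function that moves the
-- derivative onto `u`. As `η` is nonnegative with integral one, each partial derivative is an
-- average of `g l` and inherits the bound `L`; the factor `d` comes from passing to the operator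
-- norm.
open scoped Convolution in
theorem norm_fderiv_mollification_le {d : ℕ} {D : Set (Pt d)} (hD : MeasurableSet D)
    {u : Pt d → ℝ} {g : Fin d → Pt d → ℝ} {L : ℝ} (hL : 0 ≤ L) (hu : IntegrableOn u D)
    (hg : ∀ l, ∀ᵐ x ∂volume.restrict D, |g l x| ≤ L) (hw : HasWeakPartials D u g)
    (φ : ContDiffBump (0 : Pt d)) {x : Pt d} (hx : Metric.closedBall x φ.rOut ⊆ D) :
    ∃ f' : Pt d →L[ℝ] ℝ,
      HasFDerivAt (D.indicator u ⋆[ContinuousLinearMap.lsmul ℝ ℝ] φ.normed volume) f' x ∧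
        ‖f'‖ ≤ d * L := by
  set η := φ.normed (volume : Measure (Pt d)) with hη
  have hηs : ContDiff ℝ ∞ η := φ.contDiff_normed
  have hui : Integrable (D.indicator u) := hu.integrable_indicator hD
  have hder := (φ.hasCompactSupport_normed (μ := volume)).hasFDerivAt_convolution_right
    (ContinuousLinearMap.lsmul ℝ ℝ) hui.locallyIntegrable (hηs.of_le (by simp)) x
  refine ⟨_, hder, opNorm_le_of_single_le _ hL fun l => ?_⟩
  rw [convolution_precompR_apply]
  rotate_left
  · exact hui.locallyIntegrable
  · exact φ.hasCompactSupport_normed.fderiv ℝ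
  · exact hηs.continuous_fderiv (by simp)
  have hψs : ContDiff ℝ ∞ fun t => η (x - t) := hηs.comp (contDiff_const.sub contDiff_id)
  have hsupp : tsupport (fun t => η (x - t)) ⊆ Metric.closedBall x φ.rOut := by
    refine closure_minimal (fun t ht => ?_) Metric.isClosed_closedBall
    have : x - t ∈ Function.support η := ht
    rw [hη, φ.support_normed_eq] at this
    rw [Metric.mem_closedBall, dist_comm, dist_eq_norm]
    simpa using (mem_ball_zero_iff.1 this).le
  have hψc : HasCompactSupport fun t => η (x - t) :=
    (isCompact_closedBall x φ.rOut).of_isClosed_subset (isClosed_tsupport _) hsupp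
  have key := hw _ hψs hψc (hsupp.trans hx) l
  have hfd : ∀ t, fderiv ℝ (fun t => η (x - t)) t (EuclideanSpace.single l 1) =
      -(fderiv ℝ η (x - t) (EuclideanSpace.single l 1)) := by
    intro t
    have h1 : HasFDerivAt η (fderiv ℝ η (x - t)) (x - t) :=
      (hηs.differentiable (by simp) _).hasFDerivAt
    have h2 : HasFDerivAt (fun t : Pt d => x - t) (-(ContinuousLinearMap.id ℝ (Pt d))) t :=
      (hasFDerivAt_id t).const_sub x
    have h3 : HasFDerivAt (fun t => η (x - t)) _ t := h1.comp t h2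
    rw [h3.fderiv]
    simp
  simp only [hfd, mul_neg, integral_neg, neg_inj] at key
  have hconv : (D.indicator u ⋆[ContinuousLinearMap.lsmul ℝ ℝ]
      fun a => fderiv ℝ η a (EuclideanSpace.single l 1)) x = ∫ t in D, g l t * η (x - t) := by
    rw [← key, ← integral_indicator hD, convolution_def]
    refine integral_congr_ae (Eventually.of_forall fun t => ?_)
    by_cases ht : t ∈ D <;> simp [ht]
  rw [hconv]
  exact abs_setIntegral_mul_le (hg l) (hψs.continuous.integrable_of_hasCompactSupport hψc)
    (fun t => φ.nonneg_normed _) hL (by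
      rw [integral_sub_left_eq_self]; exact φ.integral_normed)

open scoped Convolution in
/-- A function with bounded weak partial derivatives on a convex open set is Lipschitz there, up
to a null set. -/
theorem HasWeakPartials.lipschitz {d : ℕ} {D : Set (Pt d)} (hD : IsOpen D) (hDc : Convex ℝ D)
    {u : Pt d → ℝ} {g : Fin d → Pt d → ℝ} {L : ℝ} (hL : 0 ≤ L) (hu : IntegrableOn u D)
    (hg : ∀ l, ∀ᵐ x ∂volume.restrict D, |g l x| ≤ L) (hw : HasWeakPartials D u g) :
    ∃ S : Set (Pt d), (∀ᵐ x, x ∈ S) ∧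
      ∀ y ∈ S ∩ D, ∀ z ∈ S ∩ D, |u y - u z| ≤ d * L * ‖y - z‖ := by
  have hb : ∀ k : ℕ, (0 : ℝ) < 1 / (k + 1) := fun k => by positivity
  let φ : ℕ → ContDiffBump (0 : Pt d) := fun k =>
    { rIn := 1 / (k + 1), rOut := 2 * (1 / (k + 1)), rIn_pos := hb k,
      rIn_lt_rOut := by linarith [hb k] }
  have hφ : Tendsto (fun k => (φ k).rOut) atTop (𝓝 0) := by
    have := (tendsto_one_div_add_atTop_nhds_zero_nat (𝕜 := ℝ)).const_mul 2
    rwa [mul_zero] at this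
  have hui : Integrable (D.indicator u) := hu.integrable_indicator hD.measurableSet
  have hae := ContDiffBump.ae_convolution_tendsto_right_of_locallyIntegrable (μ := volume)
    (φ := φ) (K := 2) hφ (Eventually.of_forall fun k => le_rfl) hui.locallyIntegrable
  -- The set of full measure consists of the points where the mollifications converge to the zero
  -- extension of `u`.
  refine ⟨_, hae, fun y hy z hz => ?_⟩
  set w : ℕ → Pt d → ℝ := fun k =>
    D.indicator u ⋆[ContinuousLinearMap.lsmul ℝ ℝ] (φ k).normed volume with hwdef
  have hlim : ∀ p ∈ {x | Tendsto (fun i ↦ ((φ i).normed volume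
      ⋆[ContinuousLinearMap.lsmul ℝ ℝ, volume] D.indicator u) x) atTop (𝓝 (D.indicator u x))} ∩ D,
      Tendsto (fun k => w k p) atTop (𝓝 (u p)) := by
    rintro p ⟨hp, hpD⟩
    have hp' : Tendsto _ _ _ := hp
    rw [Set.indicator_of_mem hpD] at hp'
    refine hp'.congr fun k => ?_
    simp only [hwdef]
    rw [convolution_eq_swap, convolution_def]
    refine integral_congr_ae (Eventually.of_forall fun t => ?_)
    simp [mul_comm]
  have hcomp : IsCompact (segment ℝ y z) := by
    rw [← convexHull_pair (𝕜 := ℝ)]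
    exact (Set.toFinite {y, z}).isCompact_convexHull ℝ
  -- Once the mollification radius is below `ε`, all the balls centred on the segment stay in `D`;
  -- the mean value inequality along the segment then passes to the limit.
  obtain ⟨ε, hε, hεD⟩ := hcomp.exists_cthickening_subset_open hD (hDc.segment_subset hy.2 hz.2)
  refine le_of_tendsto ((hlim y hy).sub (hlim z hz)).abs ?_
  filter_upwards [hφ.eventually (gt_mem_nhds hε)] with k hk
  have hder : ∀ x ∈ segment ℝ y z, ∃ f' : Pt d →L[ℝ] ℝ, HasFDerivAt (w k) f' x ∧ ‖f'‖ ≤ d * L :=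
    fun x hx => norm_fderiv_mollification_le hD.measurableSet hL hu hg hw (φ k)
      ((Metric.closedBall_subset_closedBall hk.le).trans
        ((Metric.closedBall_subset_cthickening hx ε).trans hεD))
  choose! f' hf' using hder
  have := (convex_segment y z).norm_image_sub_le_of_norm_hasFDerivWithin_le (f := w k) (f' := f')
    (C := d * L) (fun x hx => (hf' x hx).1.hasFDerivWithinAt) (fun x hx => (hf' x hx).2)
    (right_mem_segment ℝ y z) (left_mem_segment ℝ y z)
  simpa using this

theorem HasWeakPartials.mono {d : ℕ} {D Ω : Set (Pt d)} (hDΩ : D ⊆ Ω)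
    {u : Pt d → ℝ} {g : Fin d → Pt d → ℝ} (hw : HasWeakPartials Ω u g) :
    HasWeakPartials D u g := by
  intro φ hφ hφc hφD l
  have h := hw φ hφ hφc (hφD.trans hDΩ) l
  have h0 : ∀ x, x ∉ D → φ x = 0 := fun x hx => image_eq_zero_of_notMem_tsupport fun h => hx (hφD h)
  have h1 : ∀ x, x ∉ D → fderiv ℝ φ x = 0 := fun x hx =>
    image_eq_zero_of_notMem_tsupport fun h => hx (hφD (tsupport_fderiv_subset ℝ h))
  have aux : ∀ f : Pt d → ℝ, (∀ x, x ∉ D → f x = 0) → ∫ x in Ω, f x = ∫ x in D, f x := by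
    intro f hf
    rw [setIntegral_eq_integral_of_forall_compl_eq_zero hf,
      setIntegral_eq_integral_of_forall_compl_eq_zero fun x hx => hf x fun h => hx (hDΩ h)]
  rw [aux _ fun x hx => by simp [h1 x hx], aux _ fun x hx => by simp [h0 x hx]] at h
  exact h

/-- The weak partial derivatives of a smooth function are its classical partial derivatives. -/
theorem HasWeakPartials.ae_eq_fderiv {d : ℕ} {D : Set (Pt d)} (hD : IsOpen D)
    {u : Pt d → ℝ} (hu : ContDiff ℝ 1 u) {g : Fin d → Pt d → ℝ}
    (hg : ∀ l, LocallyIntegrableOn (g l) D) (hw : HasWeakPartials D u g) (l : Fin d) :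
    ∀ᵐ x ∂volume.restrict D, g l x = fderiv ℝ u x (EuclideanSpace.single l 1) := by
  set e : Pt d := EuclideanSpace.single l 1
  have hcont : Continuous fun x => fderiv ℝ u x e :=
    (hu.continuous_fderiv (by simp)).clm_apply continuous_const
  have hli : LocallyIntegrableOn (fun x => g l x - fderiv ℝ u x e) D :=
    (hg l).sub ((hcont.locallyIntegrable (μ := volume)).locallyIntegrableOn D)
  have := hD.ae_eq_zero_of_integral_contDiff_smul_eq_zero (μ := volume) hli fun φ hφ hφc hφD => by
    have h0 : ∀ x, x ∉ D → φ x = 0 :=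
      fun x hx => image_eq_zero_of_notMem_tsupport fun h => hx (hφD h)
    have h1 : ∀ x, x ∉ D → fderiv ℝ φ x = 0 := fun x hx =>
      image_eq_zero_of_notMem_tsupport fun h => hx (hφD (tsupport_fderiv_subset ℝ h))
    have hk := hw φ hφ hφc hφD l
    rw [setIntegral_eq_integral_of_forall_compl_eq_zero (fun x hx => by simp [h1 x hx]),
      setIntegral_eq_integral_of_forall_compl_eq_zero (fun x hx => by simp [h0 x hx])] at hk
    have hφ' : Continuous fun x => fderiv ℝ φ x e :=
      (hφ.continuous_fderiv (by simp)).clm_apply continuous_const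
    have hφ'c : HasCompactSupport fun x => fderiv ℝ φ x e := hφc.fderiv_apply ℝ e
    have i1 : Integrable fun x => fderiv ℝ u x e * φ x :=
      (hcont.mul hφ.continuous).integrable_of_hasCompactSupport hφc.mul_left
    have i2 : Integrable fun x => u x * fderiv ℝ φ x e :=
      (hu.continuous.mul hφ').integrable_of_hasCompactSupport hφ'c.mul_left
    have i3 : Integrable fun x => u x * φ x :=
      (hu.continuous.mul hφ.continuous).integrable_of_hasCompactSupport hφc.mul_left
    -- Classical integration by parts shows that `g l` and the classical partial derivative pair
    -- equally with every test function; the fundamental lemma of the calculus of variations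
    -- concludes.
    have hp := integral_mul_fderiv_eq_neg_fderiv_mul_of_integrable (μ := volume) i1 i2 i3
      (fun x _ => hu.differentiable (by simp) x)
      (fun x _ => hφ.differentiable (by simp) x)
    rw [hp, neg_inj] at hk
    have i4 : Integrable fun x => g l x * φ x := by
      have h5 : IntegrableOn (fun x => φ x • g l x) (tsupport φ) :=
        ((hg l).integrableOn_compact_subset hφD hφc).continuousOn_smul
          hφ.continuous.continuousOn hφc
      rw [integrableOn_iff_integrable_of_support_subset] at h5
      · simpa [mul_comm] using h5
      · intro x hx
        refine subset_tsupport _ fun h => hx ?_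
        simp [h]
    calc ∫ x, φ x • (g l x - fderiv ℝ u x e) = ∫ x, (g l x * φ x - fderiv ℝ u x e * φ x) :=
          integral_congr_ae (Eventually.of_forall fun x => by simp; ring)
      _ = 0 := by rw [integral_sub i4 i1, hk, sub_self]
  rw [ae_restrict_iff' hD.measurableSet]
  filter_upwards [this] with x hx hxD
  linarith [hx hxD]

/-! ### Shape functions and equivalence of norms on the reference cell -/

theorem contDiff_eval_mvPolynomial {d : ℕ} (p : MvPolynomial (Fin d) ℝ) :
    ContDiff ℝ ∞ fun y : Pt d => MvPolynomial.eval (fun l => y l) p := by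
  induction p using MvPolynomial.induction_on with
  | C a => simpa using contDiff_const
  | add p q hp hq => simpa using hp.add hq
  | mul_X p i hp =>
    simp only [map_mul, MvPolynomial.eval_X]
    exact hp.mul (contDiff_piLp_apply 2)

/-- A positive definite continuous form, homogeneous of degree two, dominates the squared norm. -/
theorem exists_sq_norm_le_of_homogeneous {E : Type*} [NormedAddCommGroup E] [NormedSpace ℝ E]
    [FiniteDimensional ℝ E] {p : E → ℝ} (hp : Continuous p)
    (hom : ∀ (t : ℝ) (x : E), p (t • x) = t ^ 2 * p x) (pos : ∀ x, x ≠ 0 → 0 < p x) :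
    ∃ C : ℝ, 0 < C ∧ ∀ x, ‖x‖ ^ 2 ≤ C * p x := by
  have h0 : p 0 = 0 := by simpa using hom 0 0
  rcases (Metric.sphere (0 : E) 1).eq_empty_or_nonempty with he | hne
  · refine ⟨1, one_pos, fun x => ?_⟩
    rcases eq_or_ne x 0 with rfl | hx
    · simp [h0]
    · exact absurd he (Set.Nonempty.ne_empty ⟨‖x‖⁻¹ • x, by simp [norm_smul, hx]⟩)
  · obtain ⟨x₀, hx₀, hmin⟩ := (isCompact_sphere (0 : E) 1).exists_isMinOn hne hp.continuousOn
    have hx₀' : x₀ ≠ 0 := by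
      rintro rfl
      simp at hx₀
    refine ⟨(p x₀)⁻¹, inv_pos.2 (pos _ hx₀'), fun x => ?_⟩
    rcases eq_or_ne x 0 with rfl | hx
    · simp [h0]
    · have h1 : p x₀ ≤ p (‖x‖⁻¹ • x) := hmin (by simp [norm_smul, hx])
      have hxn : 0 < ‖x‖ := norm_pos_iff.2 hx
      rw [hom, inv_pow, ← div_eq_inv_mul, le_div_iff₀ (by positivity)] at h1
      rw [← div_eq_inv_mul, le_div_iff₀ (pos _ hx₀')]
      linarith

/-- Continuity upgrades vanishing almost everywhere to vanishing on the interior, and a convex set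
with nonempty interior lies in the closure of its interior. This brings the nodes on the boundary of
`K` within reach. -/
theorem eqOn_zero_of_setIntegral_eq_zero {d : ℕ} {K : Set (Pt d)} (hK : IsCompact K)
    (hKconv : Convex ℝ K) (hKi : (interior K).Nonempty) {f : Pt d → ℝ} (hf : Continuous f)
    (hf0 : ∀ x, 0 ≤ f x) (h : ∫ x in K, f x = 0) : ∀ x ∈ K, f x = 0 := by
  have h1 : f =ᵐ[volume.restrict K] 0 :=
    (setIntegral_eq_zero_iff_of_nonneg_ae (Eventually.of_forall hf0)
      (hf.continuousOn.integrableOn_compact hK)).1 h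
  have h2 : f =ᵐ[volume.restrict (interior K)] fun _ => 0 :=
    ae_restrict_of_ae_restrict_of_subset interior_subset h1
  have h3 : Set.EqOn f (fun _ => 0) (interior K) :=
    Measure.eqOn_open_of_ae_eq h2 isOpen_interior hf.continuousOn continuousOn_const
  have h4 := h3.closure hf continuous_const
  rw [hKconv.closure_interior_eq_closure_of_nonempty_interior hKi] at h4
  exact fun x hx => h4 (subset_closure hx)

namespace LagrangeElement

variable {d : ℕ} {K : Set (Pt d)} (R : LagrangeElement K)

/-- The shape functions as functions on space. -/
def shapeFn (a : Fin R.num) (y : Pt d) : ℝ := MvPolynomial.eval (fun l => y l) (R.shape a)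

/-- The function on the reference cell with nodal values `c`. -/
def refFn (c : Fin R.num → ℝ) (y : Pt d) : ℝ := ∑ a, c a * R.shapeFn a y

theorem contDiff_shapeFn (a : Fin R.num) : ContDiff ℝ ∞ (R.shapeFn a) :=
  contDiff_eval_mvPolynomial _

theorem contDiff_refFn (c : Fin R.num → ℝ) : ContDiff ℝ ∞ (R.refFn c) :=
  ContDiff.sum fun a _ => contDiff_const.mul (R.contDiff_shapeFn a)

theorem shapeFn_node (a b : Fin R.num) : R.shapeFn a (R.node b) = if a = b then 1 else 0 :=
  R.shape_node a b

theorem refFn_node (c : Fin R.num → ℝ) (b : Fin R.num) : R.refFn c (R.node b) = c b := by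
  simp [refFn, shapeFn_node]

theorem sum_shapeFn (y : Pt d) : ∑ a, R.shapeFn a y = 1 := by
  have := congrArg (MvPolynomial.eval fun l => y l) R.sum_shape
  simpa [shapeFn] using this

theorem num_pos : 0 < R.num := by
  rcases Nat.eq_zero_or_pos R.num with h | h
  · have := R.sum_shapeFn 0
    have : IsEmpty (Fin R.num) := by rw [h]; infer_instance
    simp_all
  · exact h

theorem refFn_smul (t : ℝ) (c : Fin R.num → ℝ) : R.refFn (t • c) = t • R.refFn c := by
  ext y
  simp [refFn, Finset.mul_sum, mul_assoc]

theorem refFn_sub_const (c : Fin R.num → ℝ) (t : ℝ) (y : Pt d) :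
    R.refFn (fun a => c a - t) y = R.refFn c y - t := by
  simp only [refFn, sub_mul, Finset.sum_sub_distrib, ← Finset.mul_sum, R.sum_shapeFn, mul_one]

theorem fderiv_refFn (c : Fin R.num → ℝ) (y : Pt d) :
    fderiv ℝ (R.refFn c) y = ∑ a, c a • fderiv ℝ (R.shapeFn a) y := by
  have h : HasFDerivAt (R.refFn c) (∑ a, c a • fderiv ℝ (R.shapeFn a) y) y :=
    HasFDerivAt.fun_sum fun a _ =>
      (((R.contDiff_shapeFn a).differentiable (by simp) y).hasFDerivAt.const_mul (c a))
  exact h.fderiv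

theorem exists_sum_abs_shapeFn_le (hK : IsCompact K) :
    ∃ S : ℝ, 0 < S ∧ ∀ y ∈ K, ∑ a, |R.shapeFn a y| ≤ S := by
  have hc : Continuous fun y => ∑ a, |R.shapeFn a y| :=
    continuous_finsetSum _ fun a _ => (R.contDiff_shapeFn a).continuous.abs
  obtain ⟨S, hS⟩ := (hK.image hc).bddAbove
  exact ⟨max S 1, by positivity, fun y hy => (hS ⟨y, hy, rfl⟩).trans (le_max_left _ _)⟩

theorem abs_refFn_le {S : ℝ} {y : Pt d} (hS : ∑ a, |R.shapeFn a y| ≤ S) (c : Fin R.num → ℝ) :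
    |R.refFn c y| ≤ ‖c‖ * S := by
  calc |R.refFn c y| ≤ ∑ a, |c a * R.shapeFn a y| := Finset.abs_sum_le_sum_abs _ _
    _ ≤ ∑ a, ‖c‖ * |R.shapeFn a y| := Finset.sum_le_sum fun a _ => by
        rw [abs_mul]
        exact mul_le_mul_of_nonneg_right (norm_le_pi_norm c a) (abs_nonneg _)
    _ ≤ ‖c‖ * S := by
        rw [← Finset.mul_sum]
        exact mul_le_mul_of_nonneg_left hS (norm_nonneg _)

/-- The integral is a quadratic form in the nodal values. It is definite because a combination of
shape functions vanishing on `K` vanishes at the nodes, where duality reads off its coefficients. -/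
theorem exists_sq_norm_le_integral (hK : IsCompact K) (hKconv : Convex ℝ K)
    (hKi : (interior K).Nonempty) :
    ∃ C : ℝ, 0 < C ∧ ∀ c, ‖c‖ ^ 2 ≤ C * ∫ y in K, R.refFn c y ^ 2 := by
  refine exists_sq_norm_le_of_homogeneous ?_ ?_ ?_
  · refine continuous_parametric_integral_of_continuous ?_ hK
    simp only [Function.uncurry_def, refFn]
    refine (continuous_finsetSum _ fun a _ => ?_).pow 2
    exact ((continuous_apply a).comp continuous_fst).mul
      ((R.contDiff_shapeFn a).continuous.comp continuous_snd)
  · intro t c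
    simp [refFn_smul, mul_pow, integral_const_mul]
  · intro c hc
    refine (integral_nonneg fun y => sq_nonneg _).lt_of_ne fun h => hc ?_
    have := eqOn_zero_of_setIntegral_eq_zero hK hKconv hKi
      ((R.contDiff_refFn c).continuous.pow 2) (fun y => sq_nonneg _) h.symm
    ext b
    have := this _ (R.node_mem b)
    rw [Pi.pow_apply, refFn_node] at this
    simpa using this

/-- The gradient form only sees nodal values modulo constants. Adding `c b ^ 2` makes it definite: a
function with zero gradient on the convex set `K` is constant there, and its value at node `b` is
zero. For the shifted vector `c - c b` the added term vanishes, and the gradient is unchanged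
because the shape functions sum to one. -/
theorem exists_sq_norm_le_integral_fderiv (hK : IsCompact K) (hKconv : Convex ℝ K)
    (hKi : (interior K).Nonempty) (b : Fin R.num) :
    ∃ C : ℝ, 0 < C ∧ ∀ c : Fin R.num → ℝ,
      ‖fun a => c a - c b‖ ^ 2 ≤ C * ∫ y in K, ‖fderiv ℝ (R.refFn c) y‖ ^ 2 := by
  have hcont : Continuous fun c : Fin R.num → ℝ =>
      c b ^ 2 + ∫ y in K, ‖fderiv ℝ (R.refFn c) y‖ ^ 2 := by
    refine ((continuous_apply b).pow 2).add (continuous_parametric_integral_of_continuous ?_ hK)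
    simp only [Function.uncurry_def, fderiv_refFn]
    refine (continuous_finsetSum _ fun a _ => ?_).norm.pow 2
    exact ((continuous_apply a).comp continuous_fst).smul
      (((R.contDiff_shapeFn a).continuous_fderiv (by simp)).comp continuous_snd)
  obtain ⟨C, hC, h⟩ := exists_sq_norm_le_of_homogeneous hcont (fun t c => by
      have h1 : ∀ y, ‖fderiv ℝ (R.refFn (t • c)) y‖ ^ 2 =
          t ^ 2 * ‖fderiv ℝ (R.refFn c) y‖ ^ 2 := fun y => by
        have : fderiv ℝ (R.refFn (t • c)) y = t • fderiv ℝ (R.refFn c) y := by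
          simp [fderiv_refFn, Finset.smul_sum, mul_smul]
        rw [this, norm_smul, mul_pow, Real.norm_eq_abs, sq_abs]
      simp [h1, mul_pow, integral_const_mul, mul_add]) (fun c hc => by
      have hnn : 0 ≤ ∫ y in K, ‖fderiv ℝ (R.refFn c) y‖ ^ 2 := integral_nonneg fun y => sq_nonneg _
      refine (add_nonneg (sq_nonneg _) hnn).lt_of_ne fun h => hc ?_
      have hb : c b = 0 := by nlinarith [sq_nonneg (c b)]
      have hi : ∫ y in K, ‖fderiv ℝ (R.refFn c) y‖ ^ 2 = 0 := by nlinarith [sq_nonneg (c b)]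
      have h0 := eqOn_zero_of_setIntegral_eq_zero hK hKconv hKi
        (((R.contDiff_refFn c).continuous_fderiv (by simp)).norm.pow 2) (fun y => sq_nonneg _) hi
      ext a
      have := hKconv.norm_image_sub_le_of_norm_hasFDerivWithin_le (f := R.refFn c)
        (f' := fderiv ℝ (R.refFn c)) (C := 0)
        (fun y _ => ((R.contDiff_refFn c).differentiable (by simp) y).hasFDerivAt.hasFDerivWithinAt)
        (fun y hy => by have := h0 y hy; simp at this; simp [this]) (R.node_mem b) (R.node_mem a)
      simpa [refFn_node, hb] using this)
  refine ⟨C, hC, fun c => ?_⟩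
  have h1 := h fun a => c a - c b
  have h2 : fderiv ℝ (R.refFn fun a => c a - c b) = fderiv ℝ (R.refFn c) := by
    have : (R.refFn fun a => c a - c b) = fun y => R.refFn c y - c b :=
      funext fun y => R.refFn_sub_const c _ y
    ext1 y
    rw [this, fderiv_sub_const]
  simpa [h2] using h1

/-- Inverse estimate: point values are bounded by the `L²` norm on the reference cell. -/
theorem exists_sq_refFn_le (hK : IsCompact K) (hKconv : Convex ℝ K)
    (hKi : (interior K).Nonempty) :
    ∃ C : ℝ, 0 < C ∧ ∀ c, ∀ y ∈ K, R.refFn c y ^ 2 ≤ C * ∫ y in K, R.refFn c y ^ 2 := by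
  obtain ⟨S, hS, hS'⟩ := R.exists_sum_abs_shapeFn_le hK
  obtain ⟨C, hC, hC'⟩ := R.exists_sq_norm_le_integral hK hKconv hKi
  refine ⟨S ^ 2 * C, by positivity, fun c y hy => ?_⟩
  calc R.refFn c y ^ 2 = |R.refFn c y| ^ 2 := (sq_abs _).symm
    _ ≤ (‖c‖ * S) ^ 2 := by gcongr; exact R.abs_refFn_le (hS' y hy) c
    _ = S ^ 2 * ‖c‖ ^ 2 := by ring
    _ ≤ S ^ 2 * (C * ∫ y in K, R.refFn c y ^ 2) := by gcongr; exact hC' c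
    _ = _ := by ring

/-- Inverse estimate: the oscillation is bounded by the `L²` norm of the gradient on the
reference cell. -/
theorem exists_sq_refFn_sub_le (hK : IsCompact K) (hKconv : Convex ℝ K)
    (hKi : (interior K).Nonempty) :
    ∃ C : ℝ, 0 < C ∧ ∀ c, ∀ y ∈ K, ∀ z ∈ K,
      (R.refFn c y - R.refFn c z) ^ 2 ≤ C * ∫ y in K, ‖fderiv ℝ (R.refFn c) y‖ ^ 2 := by
  obtain ⟨S, hS, hS'⟩ := R.exists_sum_abs_shapeFn_le hK
  obtain ⟨C, hC, hC'⟩ := R.exists_sq_norm_le_integral_fderiv hK hKconv hKi ⟨0, R.num_pos⟩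
  refine ⟨4 * S ^ 2 * C, by positivity, fun c y hy z hz => ?_⟩
  set b : Fin R.num := ⟨0, R.num_pos⟩
  have hy' := R.abs_refFn_le (hS' y hy) fun a => c a - c b
  have hz' := R.abs_refFn_le (hS' z hz) fun a => c a - c b
  rw [refFn_sub_const] at hy' hz'
  have h : |R.refFn c y - R.refFn c z| ≤ 2 * (‖fun a => c a - c b‖ * S) := by
    rw [abs_le] at *
    constructor <;> linarith
  calc (R.refFn c y - R.refFn c z) ^ 2 = |R.refFn c y - R.refFn c z| ^ 2 := (sq_abs _).symm
    _ ≤ (2 * (‖fun a => c a - c b‖ * S)) ^ 2 := by gcongr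
    _ = 4 * S ^ 2 * ‖fun a => c a - c b‖ ^ 2 := by ring
    _ ≤ 4 * S ^ 2 * (C * ∫ y in K, ‖fderiv ℝ (R.refFn c) y‖ ^ 2) := by gcongr; exact hC' c
    _ = _ := by ring

end LagrangeElement

/-! ### Geometry of the cells and splitting of integrals over the mesh -/

namespace AffineMesh

variable {d : ℕ} {K Ω : Set (Pt d)} (T : AffineMesh K Ω)

/-- The `i`-th cell of the mesh. -/
def cell (i : Fin T.num) : Set (Pt d) := T.map i '' K

/-- The `i`-th cell map as a continuous affine equivalence. -/
def cmap (i : Fin T.num) : Pt d ≃ᴬ[ℝ] Pt d := AffineEquiv.toContinuousAffineEquiv (T.map i)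

/-- The linear part of the `i`-th cell map. -/
def lin (i : Fin T.num) : Pt d →L[ℝ] Pt d := (T.cmap i : Pt d →ᴬ[ℝ] Pt d).contLinear

theorem hasFDerivAt_map (i : Fin T.num) (y : Pt d) : HasFDerivAt (T.map i) (T.lin i) y :=
  (T.cmap i : Pt d →ᴬ[ℝ] Pt d).hasFDerivAt

theorem continuous_map (i : Fin T.num) : Continuous (T.map i) := (T.cmap i).continuous

theorem contDiff_map_symm (i : Fin T.num) {m : WithTop ℕ∞} : ContDiff ℝ m (T.map i).symm :=
  ((T.cmap i).symm : Pt d →ᴬ[ℝ] Pt d).contDiff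

theorem lin_apply (i : Fin T.num) (x y : Pt d) :
    T.lin i (x - y) = T.map i x - T.map i y :=
  (T.map i).toAffineMap.linearMap_vsub x y

theorem isCompact_cell (hK : IsCompact K) (i : Fin T.num) : IsCompact (T.cell i) :=
  hK.image (T.continuous_map i)

theorem convex_cell (hKconv : Convex ℝ K) (i : Fin T.num) : Convex ℝ (T.cell i) :=
  hKconv.affine_image (T.map i).toAffineMap

theorem interior_cell_nonempty (hKi : (interior K).Nonempty) (i : Fin T.num) :
    (interior (T.cell i)).Nonempty := by
  have := (T.cmap i).toHomeomorph.image_interior K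
  exact (show T.cmap i '' interior K = interior (T.cell i) from this) ▸ hKi.image _

theorem mem_cell_symm {i : Fin T.num} {y : Pt d} (hy : y ∈ T.cell i) : (T.map i).symm y ∈ K := by
  obtain ⟨x, hx, rfl⟩ := hy
  simpa using hx

theorem map_node_mem_cell (R : LagrangeElement K) (i : Fin T.num) (a : Fin R.num) :
    T.map i (R.node a) ∈ T.cell i := ⟨_, R.node_mem a, rfl⟩

theorem cell_subset_closure (i : Fin T.num) : T.cell i ⊆ closure Ω := by
  rw [← T.cover]
  exact Set.subset_iUnion (fun i => T.map i '' K) i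

theorem interior_cell_subset (hreg : interior (closure Ω) = Ω) (i : Fin T.num) :
    interior (T.cell i) ⊆ Ω :=
  (interior_mono (T.cell_subset_closure i)).trans hreg.le

/-- A cell is contained in the closure of its interior, so a neighbourhood of `y` inside cell `i`
would meet the interior of cell `j`. Consequently the choice of a cell in `basisFn` is forced at
interior points of cells. -/
theorem cell_eq_of_mem (hKconv : Convex ℝ K) (hKi : (interior K).Nonempty) {i j : Fin T.num}
    {y : Pt d} (hi : y ∈ interior (T.cell i)) (hj : y ∈ T.cell j) : i = j := by
  by_contra hij
  have h1 : y ∈ closure (interior (T.cell j)) := by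
    rw [(T.convex_cell hKconv j).closure_interior_eq_closure_of_nonempty_interior
      (T.interior_cell_nonempty hKi j)]
    exact subset_closure hj
  obtain ⟨z, hz1, hz2⟩ := mem_closure_iff.1 h1 _ isOpen_interior hi
  exact Set.disjoint_left.1 (T.disjoint i j hij) hz1 hz2

theorem diam_cell_le_size (i : Fin T.num) : Metric.diam (T.cell i) ≤ T.size :=
  le_ciSup (f := fun i => Metric.diam (T.map i '' K)) (Set.finite_range _).bddAbove i

theorem dist_le_size (hK : IsCompact K) {i : Fin T.num} {x y : Pt d} (hx : x ∈ T.cell i)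
    (hy : y ∈ T.cell i) : dist x y ≤ T.size :=
  (Metric.dist_le_diam_of_mem (T.isCompact_cell hK i).isBounded hx hy).trans
    (T.diam_cell_le_size i)

theorem size_nonneg : 0 ≤ T.size := Real.iSup_nonneg fun _ => Metric.diam_nonneg

theorem size_pos (hd : 0 < d) (hK : IsCompact K) (hKi : (interior K).Nonempty) (i : Fin T.num) :
    0 < T.size := by
  obtain ⟨x, hx⟩ := hKi
  have : Nonempty (Fin d) := ⟨⟨0, hd⟩⟩
  have : Nontrivial (Pt d) := inferInstance
  obtain ⟨r, hr, hrK⟩ := Metric.isOpen_iff.1 isOpen_interior x hx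
  obtain ⟨v, hv⟩ := exists_norm_eq (Pt d) (half_pos hr).le
  have hy : x + v ∈ K := interior_subset (hrK (by simp [Metric.mem_ball, hv, hr]))
  have hne : T.map i (x + v) ≠ T.map i x := fun h => by
    have := (T.map i).injective h
    have hv0 : v = 0 := by simpa using this
    rw [hv0, norm_zero] at hv
    linarith
  exact (dist_pos.2 hne).trans_le
    (T.dist_le_size hK (i := i) ⟨_, hy, rfl⟩ ⟨_, interior_subset hx, rfl⟩)

/-- The norm of the linear part of a cell map is controlled by the mesh size. -/
theorem exists_norm_lin_le (hK : IsCompact K) (hKi : (interior K).Nonempty) :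
    ∃ C : ℝ, 0 < C ∧ ∀ (Ω : Set (Pt d)) (T : AffineMesh K Ω) (i : Fin T.num),
      ‖T.lin i‖ ≤ C * T.size := by
  obtain ⟨x, hx⟩ := hKi
  obtain ⟨r, hr, hrK⟩ := Metric.isOpen_iff.1 isOpen_interior x hx
  -- With a ball of radius `r` inside `K`, the displacement `(r / 2) • v` joins two points of `K`,
  -- so its image under the linear part has length at most the mesh size.
  refine ⟨(r / 2)⁻¹, by positivity, fun Ω T i => ?_⟩
  refine ContinuousLinearMap.opNorm_le_of_unit_norm (by have := T.size_nonneg; positivity)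
    fun v hv => ?_
  have hy : x + (r / 2) • v ∈ K :=
    interior_subset (hrK (by simp [Metric.mem_ball, norm_smul, hv, abs_of_pos hr, hr]))
  have h := T.dist_le_size hK (i := i) ⟨_, hy, rfl⟩ ⟨_, interior_subset hx, rfl⟩
  rw [dist_eq_norm, ← lin_apply, add_sub_cancel_left, map_smul, norm_smul, Real.norm_eq_abs,
    abs_of_pos (half_pos hr)] at h
  rwa [← div_eq_inv_mul, le_div_iff₀' (half_pos hr)]

section Measure

variable (hK : IsCompact K) (hKconv : Convex ℝ K) (hKi : (interior K).Nonempty)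
  (hreg : interior (closure Ω) = Ω)

include hKconv in
theorem ae_mem_interior_cell (i : Fin T.num) :
    ∀ᵐ y ∂volume.restrict (T.cell i), y ∈ interior (T.cell i) := by
  have h0 : volume (frontier (T.cell i)) = 0 := (T.convex_cell hKconv i).addHaar_frontier volume
  have h1 : ∀ᵐ y, y ∉ frontier (T.cell i) := measure_eq_zero_iff_ae_notMem.1 h0
  filter_upwards [ae_restrict_of_ae h1, ae_restrict_mem₀ ((T.convex_cell hKconv i).nullMeasurableSet
    volume)] with y hy hyc
  by_contra h
  exact hy ⟨subset_closure hyc, h⟩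

include hK hKconv hKi hreg in
-- Frontiers of convex sets are null. This makes overlaps of cells negligible; and since the
-- regularity of `Ω` places every cell interior inside `Ω`, it also shows that the cells cover
-- nothing but `Ω` up to a null set.
theorem restrict_eq_sum_cell :
    (volume.restrict Ω : Measure (Pt d)) = ∑ i, volume.restrict (T.cell i) := by
  have hU : Ω =ᵐ[volume] ⋃ i, T.cell i := by
    have h1 : Ω ⊆ ⋃ i, T.cell i := by
      rw [show (⋃ i, T.cell i) = closure Ω from T.cover]
      exact subset_closure
    have h2 : ∀ᵐ y ∂volume.restrict (⋃ i, T.cell i), y ∈ Ω := by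
      rw [ae_restrict_iUnion_iff]
      intro i
      filter_upwards [T.ae_mem_interior_cell hKconv i] with y hy
      exact T.interior_cell_subset hreg i hy
    rw [ae_restrict_iff' (MeasurableSet.iUnion fun i =>
      (T.isCompact_cell hK i).measurableSet)] at h2
    filter_upwards [h2] with y hy
    exact propext ⟨fun h => h1 h, fun h => hy h⟩
  rw [Measure.restrict_congr_set hU, Measure.restrict_iUnion_ae ?_ fun i =>
    (T.isCompact_cell hK i).measurableSet.nullMeasurableSet, Measure.sum_fintype]
  intro i j hij
  refine measure_mono_null (fun y hy => ?_)
    ((T.convex_cell hKconv i).addHaar_frontier volume)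
  exact ⟨subset_closure hy.1, fun h => hij (T.cell_eq_of_mem hKconv hKi h hy.2)⟩

include hK hKconv hKi hreg in
theorem restrict_cell_le (i : Fin T.num) :
    (volume.restrict (T.cell i) : Measure (Pt d)) ≤ volume.restrict Ω := by
  rw [T.restrict_eq_sum_cell hK hKconv hKi hreg, ← Measure.sum_fintype]
  exact Measure.le_sum (fun i => (volume.restrict (T.cell i) : Measure (Pt d))) i

include hK hKconv hKi hreg in
theorem integral_eq_sum_cell {f : Pt d → ℝ} (hf : IntegrableOn f Ω) :
    ∫ y in Ω, f y = ∑ i, ∫ y in T.cell i, f y := by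
  rw [T.restrict_eq_sum_cell hK hKconv hKi hreg, integral_finsetSum_measure]
  exact fun i _ => Integrable.mono_measure hf (T.restrict_cell_le hK hKconv hKi hreg i)

/-- The volume scale of the `i`-th cell map. -/
def jac (i : Fin T.num) : ℝ := |(T.lin i).det|

theorem jac_nonneg (i : Fin T.num) : 0 ≤ T.jac i := abs_nonneg _

include hK in
theorem integral_cell (i : Fin T.num) (f : Pt d → ℝ) :
    ∫ y in T.cell i, f y = T.jac i * ∫ y in K, f (T.map i y) := by
  rw [cell, integral_image_eq_integral_abs_det_fderiv_smul volume hK.measurableSet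
    (fun x _ => (T.hasFDerivAt_map i x).hasFDerivWithinAt) (T.map i).injective.injOn]
  simp only [smul_eq_mul]
  rw [integral_const_mul, jac]

theorem jac_pos (i : Fin T.num) : 0 < T.jac i := by
  refine abs_pos.2 fun h => ?_
  have : ((T.map i).linear : Pt d →ₗ[ℝ] Pt d).det ≠ 0 :=
    ((T.map i).linear.isUnit_det').ne_zero
  exact this h

end Measure

end AffineMesh

/-! ### Global basis functions: cellwise form, bounds, support and independence -/

namespace AffineMesh

variable {d : ℕ} {K Ω : Set (Pt d)} (T : AffineMesh K Ω) (R : LagrangeElement K)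

open Classical in
/-- The nodal values on the `i`-th cell of the function with global nodal values `c`. -/
def cellCoef {s : Finset (Pt d)} (c : s → ℝ) (i : Fin T.num) (a : Fin R.num) : ℝ :=
  ∑ x : s, if T.map i (R.node a) = x then c x else 0

theorem cellCoef_of_mem {s : Finset (Pt d)} (c : s → ℝ) (i : Fin T.num) (a : Fin R.num)
    (h : T.map i (R.node a) ∈ s) : T.cellCoef R c i a = c ⟨_, h⟩ := by
  classical
  rw [cellCoef, Finset.sum_eq_single ⟨_, h⟩]
  · simp
  · intro x _ hx
    rw [if_neg]
    exact fun h' => hx (Subtype.ext h'.symm)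
  · simp

theorem localBasisFn_eq (x : Pt d) (i : Fin T.num) (y : Pt d) :
    T.localBasisFn R x i y = open Classical in
      ∑ a, if T.map i (R.node a) = x then R.shapeFn a ((T.map i).symm y) else 0 := rfl

theorem sum_mul_localBasisFn {s : Finset (Pt d)} (c : s → ℝ) (i : Fin T.num) (y : Pt d) :
    ∑ x : s, c x * T.localBasisFn R x i y = R.refFn (T.cellCoef R c i) ((T.map i).symm y) := by
  classical
  simp only [LagrangeElement.refFn, cellCoef, localBasisFn_eq, Finset.mul_sum, Finset.sum_mul]
  rw [Finset.sum_comm]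
  refine Finset.sum_congr rfl fun a _ => Finset.sum_congr rfl fun x _ => ?_
  split_ifs <;> simp

theorem continuous_localBasisFn (x : Pt d) (i : Fin T.num) :
    Continuous (T.localBasisFn R x i) := by
  classical
  have : T.localBasisFn R x i = fun y =>
      ∑ a, if T.map i (R.node a) = x then R.shapeFn a ((T.map i).symm y) else 0 :=
    funext fun y => by rw [localBasisFn_eq]
  rw [this]
  refine continuous_finsetSum _ fun a _ => ?_
  split_ifs
  · exact (R.contDiff_shapeFn a).continuous.comp (T.contDiff_map_symm i (m := 0)).continuous
  · exact continuous_const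

theorem basisFn_eq_or (y : Pt d) :
    (∃ i, y ∈ T.cell i ∧ ∀ x, T.basisFn R x y = T.localBasisFn R x i y) ∨
      ∀ x, T.basisFn R x y = 0 := by
  by_cases h : ∃ i, y ∈ T.map i '' K
  · exact Or.inl ⟨h.choose, h.choose_spec, fun x => by rw [basisFn, dif_pos h]⟩
  · exact Or.inr fun x => by rw [basisFn, dif_neg h]

theorem basisFn_eq_of_mem_interior (hKconv : Convex ℝ K) (hKi : (interior K).Nonempty)
    (x : Pt d) {i : Fin T.num} {y : Pt d} (hy : y ∈ interior (T.cell i)) :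
    T.basisFn R x y = T.localBasisFn R x i y := by
  have h : ∃ i, y ∈ T.map i '' K := ⟨i, interior_subset hy⟩
  rw [basisFn, dif_pos h, T.cell_eq_of_mem hKconv hKi hy h.choose_spec]

/-- The identity on the interior of the cell extends by continuity to the whole cell. Point values
on shared faces, in particular at nodes, are therefore independent of the cell selected in
`basisFn`. -/
theorem basisFn_eq_of_conforming (hKconv : Convex ℝ K)
    (hKi : (interior K).Nonempty) (hT : T.IsConforming R) {x : Pt d} (hx : x ∈ T.interiorNodes R)
    {i : Fin T.num} {y : Pt d} (hy : y ∈ T.cell i) :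
    T.basisFn R x y = T.localBasisFn R x i y := by
  have h1 : Set.EqOn (T.basisFn R x) (T.localBasisFn R x i) (interior (T.cell i)) :=
    fun z hz => T.basisFn_eq_of_mem_interior R hKconv hKi x hz
  refine h1.of_subset_closure ((hT x hx).1.mono (T.cell_subset_closure i))
    (T.continuous_localBasisFn R x i).continuousOn interior_subset ?_ hy
  rw [(T.convex_cell hKconv i).closure_interior_eq_closure_of_nonempty_interior
    (T.interior_cell_nonempty hKi i)]
  exact subset_closure

theorem sum_mul_basisFn_of_mem_interior (hKconv : Convex ℝ K) (hKi : (interior K).Nonempty)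
    {s : Finset (Pt d)} (c : s → ℝ) {i : Fin T.num} {y : Pt d} (hy : y ∈ interior (T.cell i)) :
    ∑ x : s, c x * T.basisFn R x y = R.refFn (T.cellCoef R c i) ((T.map i).symm y) := by
  rw [← sum_mul_localBasisFn]
  exact Finset.sum_congr rfl fun x _ => by rw [T.basisFn_eq_of_mem_interior R hKconv hKi x hy]

/-- Pointwise sums of the basis functions are bounded by the Lebesgue constant of the element. -/
theorem sum_abs_basisFn_le {S : ℝ} (hS0 : 0 ≤ S) (hS : ∀ y ∈ K, ∑ a, |R.shapeFn a y| ≤ S)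
    (s : Finset (Pt d)) (y : Pt d) : ∑ x : s, |T.basisFn R x y| ≤ S := by
  classical
  rcases T.basisFn_eq_or R y with ⟨i, hi, h⟩ | h
  · refine le_trans ?_ (hS _ (T.mem_cell_symm hi))
    calc ∑ x : s, |T.basisFn R x y|
        ≤ ∑ x : s, ∑ a, if T.map i (R.node a) = x then
            |R.shapeFn a ((T.map i).symm y)| else 0 := by
          refine Finset.sum_le_sum fun x _ => ?_
          rw [h, localBasisFn_eq]
          refine (Finset.abs_sum_le_sum_abs _ _).trans (Finset.sum_le_sum fun a _ => ?_)
          split_ifs <;> simp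
      _ = ∑ a, ∑ x : s, if T.map i (R.node a) = x then
            |R.shapeFn a ((T.map i).symm y)| else 0 := Finset.sum_comm
      _ ≤ ∑ a, |R.shapeFn a ((T.map i).symm y)| := by
          refine Finset.sum_le_sum fun a _ => ?_
          by_cases ha : T.map i (R.node a) ∈ s
          · rw [Finset.sum_eq_single ⟨_, ha⟩]
            · simp
            · intro x _ hx
              rw [if_neg]
              exact fun h' => hx (Subtype.ext h'.symm)
            · simp
          · refine (Finset.sum_eq_zero fun x _ => ?_).trans_le (abs_nonneg _)
            rw [if_neg]
            exact fun h' => ha (h' ▸ x.2)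
  · simpa [h] using hS0

theorem abs_basisFn_le {S : ℝ} (hS0 : 0 ≤ S) (hS : ∀ y ∈ K, ∑ a, |R.shapeFn a y| ≤ S)
    (x y : Pt d) : |T.basisFn R x y| ≤ S := by
  simpa using T.sum_abs_basisFn_le R hS0 hS {x} y

/-- A nonzero value requires `x` to be a node of a cell containing `y`, and such a cell has diameter
at most the mesh size. -/
theorem basisFn_eq_zero (hK : IsCompact K) {x y : Pt d}
    (h : y ∉ Metric.closedBall x T.size) : T.basisFn R x y = 0 := by
  classical
  rcases T.basisFn_eq_or R y with ⟨i, hi, h'⟩ | h'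
  · rw [h', localBasisFn_eq]
    refine Finset.sum_eq_zero fun a _ => if_neg fun hx => h ?_
    exact T.dist_le_size hK hi (hx ▸ T.map_node_mem_cell R i a)
  · exact h' x

section Measure

variable (hK : IsCompact K) (hKconv : Convex ℝ K) (hKi : (interior K).Nonempty)
  (hreg : interior (closure Ω) = Ω)

include hK hKconv hKi hreg in
-- Measurability is not evident from the definition by choice; it holds because on each cell the
-- function agrees almost everywhere with a continuous one.
theorem memLp_basisFn (x : Pt d) : MemLp (T.basisFn R x) ⊤ (volume.restrict Ω) := by
  obtain ⟨S, hS0, hS⟩ := R.exists_sum_abs_shapeFn_le hK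
  refine memLp_top_of_bound ?_ S (Eventually.of_forall fun y => T.abs_basisFn_le R hS0.le hS x y)
  rw [T.restrict_eq_sum_cell hK hKconv hKi hreg, ← Measure.sum_fintype]
  refine AEStronglyMeasurable.sum_measure fun i => ?_
  refine (T.continuous_localBasisFn R x i).aestronglyMeasurable.congr ?_
  filter_upwards [T.ae_mem_interior_cell hKconv i] with y hy
  exact (T.basisFn_eq_of_mem_interior R hKconv hKi x hy).symm

include hK in
/-- The `L¹` norm of a basis function. -/
theorem integral_abs_basisFn_le {S : ℝ} (hS0 : 0 ≤ S)
    (hS : ∀ y ∈ K, ∑ a, |R.shapeFn a y| ≤ S) (x : Pt d) :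
    ∫ y in Ω, |T.basisFn R x y| ≤ S * volume.real (Metric.ball (0 : Pt d) 1) * T.size ^ d := by
  have hb : ∀ y, |T.basisFn R x y| ≤ (Metric.closedBall x T.size).indicator (fun _ => S) y := by
    intro y
    by_cases h : y ∈ Metric.closedBall x T.size
    · rw [Set.indicator_of_mem h]
      exact T.abs_basisFn_le R hS0 hS x y
    · rw [Set.indicator_of_notMem h, T.basisFn_eq_zero R hK h, abs_zero]
  have hi : Integrable ((Metric.closedBall x T.size).indicator fun _ => S) volume :=
    (integrable_indicator_iff measurableSet_closedBall).2
      (integrableOn_const (measure_closedBall_lt_top.ne))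
  calc ∫ y in Ω, |T.basisFn R x y|
      ≤ ∫ y in Ω, (Metric.closedBall x T.size).indicator (fun _ => S) y :=
        integral_mono_of_nonneg (Eventually.of_forall fun y => abs_nonneg _) hi.restrict
          (Eventually.of_forall hb)
    _ ≤ ∫ y, (Metric.closedBall x T.size).indicator (fun _ => S) y :=
        setIntegral_le_integral hi
          (Eventually.of_forall fun y => Set.indicator_nonneg (fun _ _ => hS0) y)
    _ = _ := by
        rw [integral_indicator measurableSet_closedBall, setIntegral_const, Measure.real,
          Measure.addHaar_closedBall _ _ T.size_nonneg, ENNReal.toReal_mul,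
          ENNReal.toReal_ofReal (by have := T.size_nonneg; positivity)]
        simp [Measure.real]
        ring

include hK hKconv hKi hreg in
/-- The basis functions are linearly independent in `L²`. -/
theorem eq_zero_of_integral_sq_eq_zero (hΩ : volume Ω ≠ ⊤) (c : T.MulDof R → ℝ)
    (h : ∫ y in Ω, (∑ x, c x * T.mulBasis R x y) ^ 2 = 0) : c = 0 := by
  have : IsFiniteMeasure (volume.restrict Ω) := ⟨by simpa using hΩ.lt_top⟩
  have hm : MemLp (fun y => ∑ x, c x * T.mulBasis R x y) ⊤ (volume.restrict Ω) :=
    memLp_finsetSum _ fun x _ => (T.memLp_basisFn R hK hKconv hKi hreg x).const_mul (c x)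
  have hint : IntegrableOn (fun y => (∑ x, c x * T.mulBasis R x y) ^ 2) Ω := by
    simp only [sq]
    exact (MemLp.mul' hm hm (r := ⊤)).integrable le_top
  rw [T.integral_eq_sum_cell hK hKconv hKi hreg hint, Finset.sum_eq_zero_iff_of_nonneg
    fun i _ => integral_nonneg fun y => sq_nonneg _] at h
  ext ⟨x, hx⟩
  -- Each global node is a node of some cell `i`, and the vanishing integral over that cell already
  -- forces its nodal values to be zero.
  obtain ⟨⟨i, a⟩, -, hxa⟩ := Finset.mem_image.1 hx
  have hi : ∫ y in T.cell i, (∑ x, c x * T.mulBasis R x y) ^ 2 =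
      ∫ y in T.cell i, R.refFn (T.cellCoef R c i) ((T.map i).symm y) ^ 2 := by
    refine integral_congr_ae ?_
    filter_upwards [T.ae_mem_interior_cell hKconv i] with y hy
    rw [← T.sum_mul_basisFn_of_mem_interior R hKconv hKi c hy]
    rfl
  have h1 := h i (Finset.mem_univ i)
  rw [hi, T.integral_cell hK] at h1
  simp only [AffineEquiv.symm_apply_apply] at h1
  have h2 : ∫ y in K, R.refFn (T.cellCoef R c i) y ^ 2 = 0 :=
    (mul_eq_zero.1 h1).resolve_left (T.jac_pos i).ne'
  obtain ⟨C, hC, hC'⟩ := R.exists_sq_norm_le_integral hK hKconv hKi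
  have h3 := hC' (T.cellCoef R c i)
  rw [h2, mul_zero] at h3
  have h4 : T.cellCoef R c i = 0 := norm_eq_zero.1 (pow_eq_zero_iff two_ne_zero |>.1
    (le_antisymm h3 (sq_nonneg _)))
  have h5 := congrFun h4 a
  subst hxa
  rwa [T.cellCoef_of_mem R c i a hx] at h5

end Measure

end AffineMesh

/-! ### The `L²` projection behind the matrix product, and testing its residual -/

section Projection

variable {α : Type*} [MeasurableSpace α] {μ : Measure α} [IsFiniteMeasure μ]

theorem integrable_mul_of_memLp_top {f g : α → ℝ} (hf : MemLp f ⊤ μ) (hg : MemLp g ⊤ μ) :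
    Integrable (fun y => f y * g y) μ :=
  (MemLp.mul' hg hf (r := ⊤)).integrable le_top

theorem integral_linearCombination_mul {I : Type*} [Fintype I] {ψ : I → α → ℝ}
    (hψ : ∀ k, MemLp (ψ k) ⊤ μ) (U : I → ℝ) {f : α → ℝ} (hf : MemLp f ⊤ μ) :
    ∫ y, (∑ k, U k * ψ k y) * f y ∂μ = ∑ k, U k * ∫ y, ψ k y * f y ∂μ := by
  simp only [Finset.sum_mul, mul_assoc]
  rw [integral_finsetSum _ fun k _ => (integrable_mul_of_memLp_top (hψ k) hf).const_mul (U k)]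
  simp only [integral_const_mul]

/-- Weighted Cauchy–Schwarz inequality. -/
theorem sq_integral_mul_le {e b : α → ℝ} (he : MemLp e ⊤ μ) (hb : MemLp b ⊤ μ)
    (hb0 : ∀ y, 0 ≤ b y) :
    (∫ y, e y * b y ∂μ) ^ 2 ≤ (∫ y, e y ^ 2 * b y ∂μ) * ∫ y, b y ∂μ := by
  have he2 : MemLp (fun y => e y ^ 2) ⊤ μ := by
    simp only [sq]
    exact MemLp.mul' he he
  have i1 := integrable_mul_of_memLp_top he2 hb
  have i2 := integrable_mul_of_memLp_top he hb
  have i3 : Integrable b μ := hb.integrable le_top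
  -- The nonnegative quadratic `t ↦ ∫ (t e + 1)² b` has nonpositive discriminant.
  have h := discrim_le_zero (a := ∫ y, e y ^ 2 * b y ∂μ) (b := 2 * ∫ y, e y * b y ∂μ)
    (c := ∫ y, b y ∂μ) fun t => by
      calc (0 : ℝ) ≤ ∫ y, (t * e y + 1) ^ 2 * b y ∂μ :=
            integral_nonneg fun y => mul_nonneg (sq_nonneg _) (hb0 y)
        _ = ∫ y, (t * t) * (e y ^ 2 * b y) + (2 * t) * (e y * b y) + b y ∂μ := by
            congr 1
            ext y
            ring
        _ = _ := by
            have i12 : Integrable (fun y => (t * t) * (e y ^ 2 * b y) +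
                (2 * t) * (e y * b y)) μ := (i1.const_mul _).add (i2.const_mul _)
            rw [integral_add i12 i3,
              integral_add (i1.const_mul _) (i2.const_mul _), integral_const_mul,
              integral_const_mul]
            ring
  rw [discrim] at h
  linarith

/-- The matrix `4 ⟨ψ_l, ψ_k⟩ - Bᵀ M⁻¹ B` applied to `U` is the pairing with the residual of the
`L²` projection of `2 ∑ U_k ψ_k` onto the span of the functions `b_j`. -/
theorem exists_projection_residual {I J : Type*} [Fintype I] [Fintype J] [DecidableEq J]
    {b : J → α → ℝ} {ψ : I → α → ℝ} (hb : ∀ j, MemLp (b j) ⊤ μ) (hψ : ∀ k, MemLp (ψ k) ⊤ μ)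
    (hli : ∀ c : J → ℝ, ∫ y, (∑ j, c j * b j y) ^ 2 ∂μ = 0 → c = 0)
    {A : Matrix I I ℝ} {B : Matrix J I ℝ} {M : Matrix J J ℝ}
    (hA : ∀ k l, A k l = 4 * ∫ y, ψ l y * ψ k y ∂μ)
    (hB : ∀ j k, B j k = ∫ y, b j y * (2 * ψ k y) ∂μ)
    (hM : ∀ i j, M i j = ∫ y, b i y * b j y ∂μ) (U : I → ℝ) :
    ∃ p : J → ℝ,
      (∀ k, ((A - Bᵀ * M⁻¹ * B) *ᵥ U) k =
        2 * ∫ y, (2 * ∑ k, U k * ψ k y - ∑ j, p j * b j y) * ψ k y ∂μ) ∧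
      ∀ q : J → ℝ, ∫ y, (2 * ∑ k, U k * ψ k y - ∑ j, p j * b j y) ^ 2 ∂μ ≤
        ∫ y, (2 * ∑ k, U k * ψ k y - ∑ j, q j * b j y) ^ 2 ∂μ := by
  have hsum : ∀ c : J → ℝ, MemLp (fun y => ∑ j, c j * b j y) ⊤ μ := fun c =>
    memLp_finsetSum _ fun j _ => (hb j).const_mul (c j)
  have hg : MemLp (fun y => ∑ k, U k * ψ k y) ⊤ μ :=
    memLp_finsetSum _ fun k _ => (hψ k).const_mul (U k)
  have hMv : ∀ (c : J → ℝ) i, (M *ᵥ c) i = ∫ y, (∑ j, c j * b j y) * b i y ∂μ := fun c i => by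
    rw [integral_linearCombination_mul hb c (hb i), Matrix.mulVec, dotProduct]
    refine Finset.sum_congr rfl fun j _ => ?_
    rw [hM, mul_comm]
    simp only [mul_comm]
  -- `M` is the Gram matrix of the `b_j`: if `M c = 0`, then `∫ (∑ c_j b_j)² = 0`, which
  -- independence excludes unless `c = 0`.
  have hunit : IsUnit M := by
    rw [← Matrix.mulVec_injective_iff_isUnit]
    refine (injective_iff_map_eq_zero M.mulVecLin).2 fun c hc => hli c ?_
    have hc' : M *ᵥ c = 0 := hc
    simp only [sq]
    rw [integral_linearCombination_mul hb c (hsum c)]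
    refine Finset.sum_eq_zero fun j _ => ?_
    have := hMv c j
    rw [hc', Pi.zero_apply] at this
    simp only [mul_comm (b j _)]
    rw [← this, mul_zero]
  set p : J → ℝ := M⁻¹ *ᵥ (B *ᵥ U) with hp
  have hMp : M *ᵥ p = B *ᵥ U := by
    rw [hp, Matrix.mulVec_mulVec, Matrix.mul_nonsing_inv _ ((Matrix.isUnit_iff_isUnit_det M).1 hunit),
      Matrix.one_mulVec]
  have hBU : ∀ j, (B *ᵥ U) j = 2 * ∫ y, (∑ k, U k * ψ k y) * b j y ∂μ := fun j => by
    rw [integral_linearCombination_mul hψ U (hb j), Matrix.mulVec, dotProduct, Finset.mul_sum]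
    refine Finset.sum_congr rfl fun k _ => ?_
    rw [hB, ← integral_const_mul, ← integral_const_mul, ← integral_mul_const]
    congr 1
    ext y
    ring
  have hAU : ∀ k, (A *ᵥ U) k = 4 * ∫ y, (∑ k, U k * ψ k y) * ψ k y ∂μ := fun k => by
    rw [integral_linearCombination_mul hψ U (hψ k), Matrix.mulVec, dotProduct, Finset.mul_sum]
    refine Finset.sum_congr rfl fun l _ => ?_
    rw [hA]
    ring
  have hBp : ∀ k, (Bᵀ *ᵥ p) k = 2 * ∫ y, (∑ j, p j * b j y) * ψ k y ∂μ := fun k => by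
    rw [integral_linearCombination_mul hb p (hψ k), Matrix.mulVec, dotProduct, Finset.mul_sum]
    refine Finset.sum_congr rfl fun j _ => ?_
    rw [Matrix.transpose_apply, hB, ← integral_const_mul, ← integral_const_mul,
      ← integral_mul_const]
    congr 1
    ext y
    ring
  set g : α → ℝ := fun y => ∑ k, U k * ψ k y with hgdef
  set e : α → ℝ := fun y => 2 * g y - ∑ j, p j * b j y with hedef
  have he : MemLp e ⊤ μ := (hg.const_mul 2).sub (hsum p)
  -- The normal equations `M p = B U` say exactly that `e` is orthogonal to every `b_j`.
  have horth : ∀ j, ∫ y, b j y * e y ∂μ = 0 := fun j => by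
    have h1 := hMv p j
    rw [hMp, hBU j] at h1
    calc ∫ y, b j y * e y ∂μ
        = ∫ y, 2 * (g y * b j y) - (∑ j, p j * b j y) * b j y ∂μ := by
          congr 1
          ext y
          simp only [hedef]
          ring
      _ = 0 := by
          rw [integral_sub ((integrable_mul_of_memLp_top hg (hb j)).const_mul 2)
            (integrable_mul_of_memLp_top (hsum p) (hb j)), integral_const_mul, h1, sub_self]
  refine ⟨p, fun k => ?_, fun q => ?_⟩
  · have h1 : ((A - Bᵀ * M⁻¹ * B) *ᵥ U) k = (A *ᵥ U) k - (Bᵀ *ᵥ p) k := by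
      rw [Matrix.sub_mulVec, Pi.sub_apply, hp, Matrix.mulVec_mulVec, Matrix.mulVec_mulVec,
        Matrix.mul_assoc]
    rw [h1, hAU, hBp]
    have h2 : ∫ y, e y * ψ k y ∂μ =
        2 * ∫ y, g y * ψ k y ∂μ - ∫ y, (∑ j, p j * b j y) * ψ k y ∂μ := by
      rw [← integral_const_mul, ← integral_sub ((integrable_mul_of_memLp_top hg (hψ k)).const_mul 2)
        (integrable_mul_of_memLp_top (hsum p) (hψ k))]
      congr 1
      ext y
      simp only [hedef]
      ring
    change _ = 2 * ∫ y, e y * ψ k y ∂μ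
    rw [h2]
    ring
  -- Pythagoras: the error of the competitor `q` is `e` plus `∑ (p_j - q_j) b_j`, and the latter is
  -- orthogonal to `e`.
  · have hz : MemLp (fun y => ∑ j, (p j - q j) * b j y) ⊤ μ := hsum fun j => p j - q j
    have h0 : ∫ y, (∑ j, (p j - q j) * b j y) * e y ∂μ = 0 := by
      rw [integral_linearCombination_mul hb _ he]
      simp [horth]
    have i1 := integrable_mul_of_memLp_top he he
    have i2 := integrable_mul_of_memLp_top hz he
    have i3 := integrable_mul_of_memLp_top hz hz
    calc ∫ y, e y ^ 2 ∂μ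
        ≤ ∫ y, e y * e y ∂μ + 2 * ∫ y, (∑ j, (p j - q j) * b j y) * e y ∂μ +
            ∫ y, (∑ j, (p j - q j) * b j y) * (∑ j, (p j - q j) * b j y) ∂μ := by
          rw [h0]
          simp only [sq]
          have : 0 ≤ ∫ y, (∑ j, (p j - q j) * b j y) * (∑ j, (p j - q j) * b j y) ∂μ :=
            integral_nonneg fun y => mul_self_nonneg _
          linarith
      _ = ∫ y, (2 * g y - ∑ j, q j * b j y) ^ 2 ∂μ := by
          have i12 : Integrable (fun y => e y * e y +
              2 * ((∑ j, (p j - q j) * b j y) * e y)) μ := i1.add (i2.const_mul 2)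
          rw [← integral_const_mul, ← integral_add i1 (i2.const_mul 2), ← integral_add i12 i3]
          congr 1
          ext y
          simp only [hedef, sub_mul, Finset.sum_sub_distrib]
          ring

/-- Summation of the weighted Cauchy–Schwarz inequality over a family of functions `ψ_{x,c}`
dominated by functions `b_x` of small mass and bounded overlap. -/
theorem sum_sq_integral_le {X C : Type*} [Fintype X] [Fintype C] {b : X → α → ℝ}
    {ψ : X × C → α → ℝ} (hb : ∀ x, MemLp (b x) ⊤ μ) {e : α → ℝ} (he : MemLp e ⊤ μ)
    {γ V S : ℝ} (hV : 0 ≤ V)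
    (hψb : ∀ k, ∀ᵐ y ∂μ, |ψ k y| ≤ γ * |b k.1 y|)
    (hbV : ∀ x, ∫ y, |b x y| ∂μ ≤ V) (hbS : ∀ y, ∑ x, |b x y| ≤ S) :
    ∑ k, (2 * ∫ y, e y * ψ k y ∂μ) ^ 2 ≤
      4 * γ ^ 2 * Fintype.card C * V * S * ∫ y, e y ^ 2 ∂μ := by
  have hba : ∀ x, MemLp (fun y => |b x y|) ⊤ μ := fun x => (hb x).norm
  have hea : MemLp (fun y => |e y|) ⊤ μ := he.norm
  have he2 : MemLp (fun y => e y ^ 2) ⊤ μ := by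
    simp only [sq]
    exact MemLp.mul' he he
  have hk : ∀ k : X × C, (2 * ∫ y, e y * ψ k y ∂μ) ^ 2 ≤
      4 * γ ^ 2 * V * ∫ y, e y ^ 2 * |b k.1 y| ∂μ := by
    intro k
    have h1 : |∫ y, e y * ψ k y ∂μ| ≤ γ * ∫ y, |e y| * |b k.1 y| ∂μ := by
      rw [← integral_const_mul, ← Real.norm_eq_abs]
      refine norm_integral_le_of_norm_le
        ((integrable_mul_of_memLp_top hea (hba k.1)).const_mul γ) ?_
      filter_upwards [hψb k] with y hy
      rw [norm_mul, Real.norm_eq_abs, Real.norm_eq_abs]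
      calc |e y| * |ψ k y| ≤ |e y| * (γ * |b k.1 y|) := by gcongr
        _ = _ := by ring
    -- With `|b_x|` as weight, one factor is the mass of `b_x`, bounded by `V`, and the other
    -- retains `e² |b_x|`, which is summed over `x` using the overlap bound `S`.
    have h2 := sq_integral_mul_le hea (hba k.1) fun y => abs_nonneg _
    simp only [sq_abs] at h2
    have h3 : 0 ≤ ∫ y, e y ^ 2 * |b k.1 y| ∂μ := integral_nonneg fun y => by positivity
    calc (2 * ∫ y, e y * ψ k y ∂μ) ^ 2 = 4 * |∫ y, e y * ψ k y ∂μ| ^ 2 := by rw [sq_abs]; ring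
      _ ≤ 4 * (γ * ∫ y, |e y| * |b k.1 y| ∂μ) ^ 2 := by gcongr
      _ = 4 * γ ^ 2 * (∫ y, |e y| * |b k.1 y| ∂μ) ^ 2 := by ring
      _ ≤ 4 * γ ^ 2 * ((∫ y, e y ^ 2 * |b k.1 y| ∂μ) * V) := by
          gcongr
          exact h2.trans (mul_le_mul_of_nonneg_left (hbV k.1) h3)
      _ = _ := by ring
  have hsum : ∑ x, ∫ y, e y ^ 2 * |b x y| ∂μ ≤ S * ∫ y, e y ^ 2 ∂μ := by
    rw [← integral_finsetSum _ fun x _ => integrable_mul_of_memLp_top he2 (hba x),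
      ← integral_const_mul]
    refine integral_mono (integrable_finsetSum _ fun x _ =>
      integrable_mul_of_memLp_top he2 (hba x)) ((he2.integrable le_top).const_mul S) fun y => ?_
    simp only [← Finset.mul_sum]
    rw [mul_comm]
    exact mul_le_mul_of_nonneg_right (hbS y) (sq_nonneg _)
  calc ∑ k, (2 * ∫ y, e y * ψ k y ∂μ) ^ 2
      ≤ ∑ k : X × C, 4 * γ ^ 2 * V * ∫ y, e y ^ 2 * |b k.1 y| ∂μ := Finset.sum_le_sum fun k _ => hk k
    _ = 4 * γ ^ 2 * V * (Fintype.card C * ∑ x, ∫ y, e y ^ 2 * |b x y| ∂μ) := by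
        rw [← Finset.mul_sum, Fintype.sum_prod_type]
        simp [Finset.mul_sum]
    _ ≤ 4 * γ ^ 2 * V * (Fintype.card C * (S * ∫ y, e y ^ 2 ∂μ)) := by gcongr
    _ = _ := by ring

end Projection

/-! ### Director functions and Lipschitz fields on the cells -/

theorem HasWeakPartials.congr {d : ℕ} {D : Set (Pt d)} (hD : MeasurableSet D) {u v : Pt d → ℝ}
    {g : Fin d → Pt d → ℝ} (h : HasWeakPartials D u g) (huv : Set.EqOn u v D) :
    HasWeakPartials D v g := by
  intro φ hφ hφc hφD l
  rw [← h φ hφ hφc hφD l]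
  exact setIntegral_congr_fun hD fun x hx => by simp only [huv hx]

theorem sq_norm_le_sum_sq {d : ℕ} (f : Pt d →L[ℝ] ℝ) :
    ‖f‖ ^ 2 ≤ ∑ l, f (EuclideanSpace.single l 1) ^ 2 := by
  set w : Pt d := WithLp.toLp 2 fun l => f (EuclideanSpace.single l 1) with hw
  have hwn : ‖w‖ ^ 2 = ∑ l, f (EuclideanSpace.single l 1) ^ 2 := by
    rw [EuclideanSpace.norm_sq_eq]
    simp [hw]
  rw [← hwn]
  have : ‖f‖ ≤ ‖w‖ := by
    refine f.opNorm_le_bound (norm_nonneg _) fun x => ?_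
    have hx : x = ∑ l, x l • EuclideanSpace.single l (1 : ℝ) := by
      ext j
      simp [Finset.sum_apply, Pi.single_apply]
    have h1 : f x = inner ℝ w x := by
      conv_lhs => rw [hx]
      simp [map_sum, PiLp.inner_apply, hw]
    rw [h1]
    exact norm_inner_le_norm w x
  gcongr

namespace IsWeakGradient

variable {d : ℕ} {Ω : Set (Pt d)} {u : Pt d → Dir} {G : Pt d → EuclideanSpace ℝ (Fin 3 × Fin d)}

theorem hasWeakPartials (h : IsWeakGradient Ω u G) (c : Fin 3) :
    HasWeakPartials Ω (fun y => u y c) fun l y => G y (c, l) :=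
  fun φ h1 h2 h3 l => h.integral_eq φ h1 h2 h3 c l

theorem locallyIntegrableOn_apply (h : IsWeakGradient Ω u G) (c : Fin 3) (l : Fin d) :
    LocallyIntegrableOn (fun y => G y (c, l)) Ω := fun x hx => by
  obtain ⟨t, ht, hi⟩ := h.locallyIntegrable_grad x hx
  exact ⟨t, ht, (EuclideanSpace.proj (c, l) :
    EuclideanSpace ℝ (Fin 3 × Fin d) →L[ℝ] ℝ).integrable_comp hi⟩

end IsWeakGradient

namespace AffineMesh

variable {d : ℕ} {K Ω : Set (Pt d)} (T : AffineMesh K Ω) (R : LagrangeElement K)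

theorem dirFun_apply (U : T.DirDof R → ℝ) (y : Pt d) (c : Fin 3) :
    T.dirFun R U y c = ∑ x : ↥(T.interiorNodes R), U (x, c) * T.basisFn R x y := by
  rw [dirFun, WithLp.ofLp_sum, Finset.sum_apply, Fintype.sum_prod_type]
  refine Finset.sum_congr rfl fun x _ => ?_
  rw [Finset.sum_eq_single c]
  · simp [dirBasis]
  · intro b _ hb
    simp [dirBasis, hb.symm]
  · simp

/-- The `c`-th component of a director function on the `i`-th cell, pulled back to the reference
cell. -/
def dirRef (U : T.DirDof R → ℝ) (i : Fin T.num) (c : Fin 3) : Fin R.num → ℝ :=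
  T.cellCoef R (fun x => U (x, c)) i

theorem dirFun_map (hKconv : Convex ℝ K) (hKi : (interior K).Nonempty) (hT : T.IsConforming R)
    (U : T.DirDof R → ℝ) (i : Fin T.num) (c : Fin 3) {y : Pt d} (hy : y ∈ T.cell i) :
    T.dirFun R U y c = R.refFn (T.dirRef R U i c) ((T.map i).symm y) := by
  rw [dirFun_apply, dirRef, ← sum_mul_localBasisFn]
  exact Finset.sum_congr rfl fun x _ => by
    rw [T.basisFn_eq_of_conforming R hKconv hKi hT x.2 hy]

theorem dirFun_frontier (hT : T.IsConforming R) (U : T.DirDof R → ℝ) {y : Pt d}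
    (hy : y ∈ frontier Ω) (c : Fin 3) : T.dirFun R U y c = 0 := by
  rw [dirFun_apply]
  exact Finset.sum_eq_zero fun x _ => by rw [(hT x x.2).2 y hy, mul_zero]

theorem ae_mem_interior_and (hKconv : Convex ℝ K) {i : Fin T.num} {p : Pt d → Prop}
    (h : ∀ᵐ y ∂volume.restrict (interior (T.cell i)), p y) :
    ∀ᵐ y ∂volume.restrict (T.cell i), p y := by
  rw [ae_restrict_iff' isOpen_interior.measurableSet] at h
  filter_upwards [ae_restrict_of_ae h, T.ae_mem_interior_cell hKconv i] with y h1 h2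
  exact h1 h2

/-- Scaling of the gradient term. -/
theorem jac_mul_integral_fderiv_le (hK : IsCompact K) (c : Fin R.num → ℝ) (i : Fin T.num) :
    T.jac i * ∫ y in K, ‖fderiv ℝ (R.refFn c) y‖ ^ 2 ≤
      ‖T.lin i‖ ^ 2 * ∫ y in T.cell i, ‖fderiv ℝ (fun z => R.refFn c ((T.map i).symm z)) y‖ ^ 2 := by
  set v : Pt d → ℝ := fun z => R.refFn c ((T.map i).symm z) with hv
  have hvs : ContDiff ℝ ∞ v := (R.contDiff_refFn c).comp (T.contDiff_map_symm i)
  have hvc : Continuous fun y => ‖fderiv ℝ v y‖ ^ 2 := (hvs.continuous_fderiv (by simp)).norm.pow 2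
  have hrc : Continuous fun y => ‖fderiv ℝ (R.refFn c) y‖ ^ 2 :=
    ((R.contDiff_refFn c).continuous_fderiv (by simp)).norm.pow 2
  -- Pulling back to the reference cell brings in the linear part of the cell map and never its
  -- inverse; this is where shape regularity is avoided.
  have hfd : ∀ y, fderiv ℝ (R.refFn c) y = (fderiv ℝ v (T.map i y)).comp (T.lin i) := fun y => by
    have h1 : R.refFn c = v ∘ T.map i := by
      ext z
      simp [hv]
    conv_lhs => rw [h1]
    exact ((hvs.differentiable (by simp) _).hasFDerivAt.comp y (T.hasFDerivAt_map i y)).fderiv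
  rw [T.integral_cell hK, ← mul_assoc, mul_comm (‖T.lin i‖ ^ 2), mul_assoc]
  refine mul_le_mul_of_nonneg_left ?_ (T.jac_nonneg i)
  rw [← integral_const_mul]
  refine setIntegral_mono_on (hrc.continuousOn.integrableOn_compact hK)
    (((hvc.comp (T.continuous_map i)).const_smul (‖T.lin i‖ ^ 2)).continuousOn.integrableOn_compact
      hK) hK.measurableSet fun y _ => ?_
  rw [hfd, ← mul_pow, mul_comm]
  gcongr
  exact ContinuousLinearMap.opNorm_comp_le _ _

section Cell

variable (hK : IsCompact K) (hKconv : Convex ℝ K) (hKi : (interior K).Nonempty)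
  (hreg : interior (closure Ω) = Ω)

include hKconv hKi hreg in
/-- On each cell, the weak gradient of a director function is its classical gradient. -/
theorem ae_fderiv_dirFun (hT : T.IsConforming R) (U : T.DirDof R → ℝ)
    {G : Pt d → EuclideanSpace ℝ (Fin 3 × Fin d)} (hG : IsWeakGradient Ω (T.dirFun R U) G)
    (i : Fin T.num) (c : Fin 3) :
    ∀ᵐ y ∂volume.restrict (T.cell i),
      ‖fderiv ℝ (fun z => R.refFn (T.dirRef R U i c) ((T.map i).symm z)) y‖ ^ 2 ≤
        ∑ l, G y (c, l) ^ 2 := by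
  have hvs : ContDiff ℝ ∞ fun z => R.refFn (T.dirRef R U i c) ((T.map i).symm z) :=
    (R.contDiff_refFn _).comp (T.contDiff_map_symm i)
  have hsub := T.interior_cell_subset hreg i
  have hw := ((hG.hasWeakPartials c).mono hsub).congr isOpen_interior.measurableSet
    (v := fun z => R.refFn (T.dirRef R U i c) ((T.map i).symm z))
    fun y hy => T.dirFun_map R hKconv hKi hT U i c (interior_subset hy)
  have h := fun l => hw.ae_eq_fderiv isOpen_interior (hvs.of_le (by simp))
    (fun l => (hG.locallyIntegrableOn_apply c l).mono_set hsub) l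
  refine T.ae_mem_interior_and hKconv ?_
  filter_upwards [ae_all_iff.2 h] with y hy
  refine (sq_norm_le_sum_sq _).trans_eq ?_
  simp only [hy]

include hK hKconv hKi hreg in
/-- A function with bounded weak derivatives is nearly constant on the cells around an interior
point. -/
theorem exists_approx_value (hΩ : IsOpen Ω) {u : Pt d → ℝ} {g : Fin d → Pt d → ℝ} {L : ℝ}
    (hL : 0 ≤ L) (hu : IntegrableOn u Ω) (hg : ∀ l, ∀ᵐ x ∂volume.restrict Ω, |g l x| ≤ L)
    (hw : HasWeakPartials Ω u g) (hsize : 0 < T.size) {x : Pt d} (hx : x ∈ Ω) :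
    ∃ m : ℝ, ∀ i, x ∈ T.cell i →
      ∀ᵐ y ∂volume.restrict (T.cell i), |u y - m| ≤ 3 * d * L * T.size := by
  obtain ⟨r, hr, hrΩ⟩ := Metric.isOpen_iff.1 hΩ x hx
  set ε := min r T.size with hε
  have hε0 : 0 < ε := lt_min hr hsize
  have hBΩ : Metric.ball x ε ⊆ Ω := (Metric.ball_subset_ball (min_le_left _ _)).trans hrΩ
  obtain ⟨S, hS, hSL⟩ := HasWeakPartials.lipschitz Metric.isOpen_ball (convex_ball x ε) hL
    (hu.mono_set hBΩ) (fun l => ae_restrict_of_ae_restrict_of_subset hBΩ (hg l)) (hw.mono hBΩ)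
  have hdense : ∀ {A D : Set (Pt d)}, (∀ᵐ y, y ∈ A) → IsOpen D → D.Nonempty → (A ∩ D).Nonempty :=
    fun hA hD hDn => by
      rw [Set.inter_comm]
      exact (Measure.dense_of_ae hA).inter_open_nonempty _ hD hDn
  -- Since `u` is determined only almost everywhere, its value at `x` is replaced by the value at a
  -- good point `w` near `x`. The point is chosen before the cell, so that one `m` serves all cells
  -- containing `x`.
  obtain ⟨w, hw'⟩ := hdense hS Metric.isOpen_ball ⟨x, Metric.mem_ball_self hε0⟩
  refine ⟨u w, fun i hxi => T.ae_mem_interior_and hKconv ?_⟩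
  have hDΩ := T.interior_cell_subset hreg i
  obtain ⟨S', hS', hSL'⟩ := HasWeakPartials.lipschitz isOpen_interior
    (T.convex_cell hKconv i).interior hL (hu.mono_set hDΩ)
    (fun l => ae_restrict_of_ae_restrict_of_subset hDΩ (hg l)) (hw.mono hDΩ)
  have hxcl : x ∈ closure (interior (T.cell i)) := by
    rw [(T.convex_cell hKconv i).closure_interior_eq_closure_of_nonempty_interior
      (T.interior_cell_nonempty hKi i)]
    exact subset_closure hxi
  have hne : (Metric.ball x ε ∩ interior (T.cell i)).Nonempty :=
    mem_closure_iff.1 hxcl _ Metric.isOpen_ball (Metric.mem_ball_self hε0)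
  -- `Ω` need not be convex, so the Lipschitz bounds on the ball and on the cell are chained through
  -- a point `z` good for both.
  obtain ⟨z, ⟨hz1, hz2⟩, hz3, hz4⟩ := hdense (A := S ∩ S') (hS.and hS')
    (Metric.isOpen_ball.inter isOpen_interior) hne
  filter_upwards [ae_restrict_of_ae hS', ae_restrict_mem isOpen_interior.measurableSet] with y hy hyD
  have h1 := hSL' y ⟨hy, hyD⟩ z ⟨hz2, hz4⟩
  have h2 := hSL z ⟨hz1, hz3⟩ w hw'
  have h3 : ‖y - z‖ ≤ T.size := by
    rw [← dist_eq_norm]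
    exact T.dist_le_size hK (interior_subset hyD) (interior_subset hz4)
  have h4 : ‖z - w‖ ≤ 2 * T.size := by
    rw [← dist_eq_norm]
    have h5 := Metric.mem_ball.1 hz3
    have h6 := Metric.mem_ball'.1 hw'.2
    have h7 := min_le_right r T.size
    linarith [dist_triangle z x w]
  have hdL : 0 ≤ d * L := by positivity
  -- The constant `3` is `1 + 2`: `y` and `z` share a cell, while `z` and `w` share a ball of radius
  -- at most the mesh size.
  calc |u y - u w| ≤ |u y - u z| + |u z - u w| := abs_sub_le _ _ _
    _ ≤ d * L * T.size + d * L * (2 * T.size) :=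
        add_le_add (h1.trans (mul_le_mul_of_nonneg_left h3 hdL))
          (h2.trans (mul_le_mul_of_nonneg_left h4 hdL))
    _ = _ := by ring

end Cell

end AffineMesh

/-! ### Interpolation of `2 n · v` in the multiplier space -/

/-- Pointwise bound for the interpolation error of a product `n · v`. -/
theorem sq_interpolation_error_le {A : Type*} [Fintype A] {ψ : A → ℝ} {S : ℝ}
    (hS : ∑ a, |ψ a| ≤ S) (hψ : ∑ a, ψ a = 1) {n v : Fin 3 → ℝ} {m V : A → Fin 3 → ℝ}
    {O W : Fin 3 → ℝ} {β Λ : ℝ} (hn : ∀ c, |n c| ≤ β)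
    (hm : ∀ a c, V a c ≠ 0 → |n c - m a c| ≤ Λ) (hO : ∀ a c, (v c - V a c) ^ 2 ≤ O c)
    (hW : ∀ a c, V a c ^ 2 ≤ W c) :
    (2 * ∑ c, n c * v c - ∑ a, (∑ c, 2 * (m a c * V a c)) * ψ a) ^ 2 ≤
      24 * S ^ 2 * ∑ c, (β ^ 2 * O c + Λ ^ 2 * W c) := by
  set E : ℝ := 24 * ∑ c, (β ^ 2 * O c + Λ ^ 2 * W c) with hE
  -- Since the `ψ a` sum to one, the error is `∑ t a * ψ a` with `t a = 2 (n · v - m a · V a)`,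
  -- written as the oscillation of `v` plus that of `n`. The constant `24 = 4 · 3 · 2` collects the
  -- square of the factor two, Cauchy–Schwarz over three components, and the square of a sum of two
  -- terms.
  set t : A → ℝ := fun a => 2 * ∑ c, (n c * (v c - V a c) + (n c - m a c) * V a c) with ht
  have hterm : ∀ a c, (n c * (v c - V a c) + (n c - m a c) * V a c) ^ 2 ≤
      2 * (β ^ 2 * O c + Λ ^ 2 * W c) := by
    intro a c
    have h1 : (n c * (v c - V a c)) ^ 2 ≤ β ^ 2 * O c := by
      rw [mul_pow, ← sq_abs (n c)]
      have := hn c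
      gcongr
      exact hO a c
    have h2 : ((n c - m a c) * V a c) ^ 2 ≤ Λ ^ 2 * W c := by
      rcases eq_or_ne (V a c) 0 with h0 | h0
      · have : 0 ≤ W c := (sq_nonneg _).trans (hW a c)
        rw [h0]
        have : 0 ≤ Λ ^ 2 * W c := by positivity
        simpa using this
      · rw [mul_pow, ← sq_abs (n c - m a c)]
        have := hm a c h0
        gcongr
        exact hW a c
    nlinarith [sq_nonneg (n c * (v c - V a c) - (n c - m a c) * V a c)]
  have htE : ∀ a, |t a| ≤ √E := fun a => by
    refine Real.abs_le_sqrt ?_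
    have h := sq_sum_le_card_mul_sum_sq (s := Finset.univ)
      (f := fun c => n c * (v c - V a c) + (n c - m a c) * V a c)
    have h' := Finset.sum_le_sum fun c (_ : c ∈ Finset.univ) => hterm a c
    rw [← Finset.mul_sum] at h'
    simp only [Finset.card_univ, Fintype.card_fin, Nat.cast_ofNat] at h
    simp only [ht, hE, mul_pow]
    linarith
  rcases isEmpty_or_nonempty A with hA | ⟨⟨a₀⟩⟩
  · simp at hψ
  have hE0 : 0 ≤ E := by
    have := fun c => (sq_nonneg _).trans (hterm a₀ c)
    have := Finset.sum_nonneg fun c (_ : c ∈ Finset.univ) => this c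
    rw [← Finset.mul_sum] at this
    linarith
  have hrew : 2 * ∑ c, n c * v c - ∑ a, (∑ c, 2 * (m a c * V a c)) * ψ a = ∑ a, t a * ψ a := by
    have h1 : 2 * ∑ c, n c * v c = ∑ a, (2 * ∑ c, n c * v c) * ψ a := by
      rw [← Finset.mul_sum, hψ, mul_one]
    rw [h1, ← Finset.sum_sub_distrib]
    refine Finset.sum_congr rfl fun a _ => ?_
    simp only [ht]
    rw [← sub_mul, Finset.mul_sum, Finset.mul_sum, ← Finset.sum_sub_distrib]
    congr 1
    exact Finset.sum_congr rfl fun c _ => by ring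
  have hbound : |∑ a, t a * ψ a| ≤ √E * S := by
    calc |∑ a, t a * ψ a| ≤ ∑ a, |t a * ψ a| := Finset.abs_sum_le_sum_abs _ _
      _ ≤ ∑ a, √E * |ψ a| := Finset.sum_le_sum fun a _ => by
          rw [abs_mul]
          exact mul_le_mul_of_nonneg_right (htE a) (abs_nonneg _)
      _ ≤ √E * S := by
          rw [← Finset.mul_sum]
          exact mul_le_mul_of_nonneg_left hS (Real.sqrt_nonneg _)
  rw [hrew, ← sq_abs]
  calc |∑ a, t a * ψ a| ^ 2 ≤ (√E * S) ^ 2 := by gcongr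
    _ = E * S ^ 2 := by rw [mul_pow, Real.sq_sqrt hE0]
    _ = _ := by rw [hE]; ring

namespace AffineMesh

variable {d : ℕ} {K Ω : Set (Pt d)} (T : AffineMesh K Ω) (R : LagrangeElement K)

theorem inner_dirBasis (n : Pt d → Dir) (k : T.DirDof R) (y : Pt d) :
    inner ℝ (n y) (T.dirBasis R k y) = T.basisFn R k.1 y * n y k.2 := by
  rw [dirBasis, EuclideanSpace.inner_single_right]
  simp

theorem sum_mul_inner_dirBasis (n : Pt d → Dir) (U : T.DirDof R → ℝ) (y : Pt d) :
    ∑ k, U k * inner ℝ (n y) (T.dirBasis R k y) = ∑ c, n y c * T.dirFun R U y c := by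
  simp only [inner_dirBasis, dirFun_apply, Finset.mul_sum]
  rw [Fintype.sum_prod_type, Finset.sum_comm]
  exact Finset.sum_congr rfl fun c _ => Finset.sum_congr rfl fun x _ => by ring

theorem memLp_dirFun (hK : IsCompact K) (hKconv : Convex ℝ K) (hKi : (interior K).Nonempty)
    (hreg : interior (closure Ω) = Ω) (U : T.DirDof R → ℝ) (c : Fin 3) :
    MemLp (fun y => T.dirFun R U y c) ⊤ (volume.restrict Ω) := by
  simp only [dirFun_apply]
  exact memLp_finsetSum _ fun x _ =>
    (T.memLp_basisFn R hK hKconv hKi hreg x).const_mul (U (x, c))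

theorem memLp_mulFun (hK : IsCompact K) (hKconv : Convex ℝ K) (hKi : (interior K).Nonempty)
    (hreg : interior (closure Ω) = Ω) (q : T.MulDof R → ℝ) :
    MemLp (fun y => ∑ j, q j * T.mulBasis R j y) ⊤ (volume.restrict Ω) :=
  memLp_finsetSum _ fun j _ => (T.memLp_basisFn R hK hKconv hKi hreg j).const_mul (q j)

theorem map_node_mem_nodes (i : Fin T.num) (a : Fin R.num) : T.map i (R.node a) ∈ T.nodes R :=
  Finset.mem_image.2 ⟨(i, a), Finset.mem_univ _, rfl⟩

end AffineMesh

open AffineMesh in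
/-- Interpolation of `2 n · v` in the multiplier space: first order in the mesh size, without
any shape regularity of the mesh. -/
theorem exists_interpolation_error_le {d : ℕ} {K : Set (Pt d)} (hK : IsCompact K)
    (hKconv : Convex ℝ K) (hKi : (interior K).Nonempty) (RV RQ : LagrangeElement K) (β Λ : ℝ) :
    ∃ C : ℝ, 0 < C ∧ ∀ (Ω : Set (Pt d)) (T : AffineMesh K Ω) (n : Pt d → Dir),
      IsOpen Ω → volume Ω ≠ ⊤ → interior (closure Ω) = Ω → T.IsConforming RV →
      (∀ c, MemLp (fun y => n y c) ⊤ (volume.restrict Ω)) →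
      (∀ c, ∀ᵐ y ∂volume.restrict Ω, |n y c| ≤ β) →
      (∀ x ∈ Ω, ∃ m : Fin 3 → ℝ, ∀ i, x ∈ T.cell i → ∀ c,
        ∀ᵐ y ∂volume.restrict (T.cell i), |n y c - m c| ≤ Λ * T.size) →
      ∀ (U : T.DirDof RV → ℝ) (G : Pt d → EuclideanSpace ℝ (Fin 3 × Fin d)),
      IsWeakGradient Ω (T.dirFun RV U) G → IntegrableOn (fun y => ‖G y‖ ^ 2) Ω →
      ∃ q : T.MulDof RQ → ℝ,
        ∫ y in Ω, (2 * ∑ k, U k * inner ℝ (n y) (T.dirBasis RV k y) -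
          ∑ j, q j * T.mulBasis RQ j y) ^ 2 ≤
        C * T.size ^ 2 * ((∫ y in Ω, ‖T.dirFun RV U y‖ ^ 2) + ∫ y in Ω, ‖G y‖ ^ 2) := by
  obtain ⟨S, hS0, hS⟩ := RQ.exists_sum_abs_shapeFn_le hK
  obtain ⟨C₁, hC₁, hW⟩ := RV.exists_sq_refFn_le hK hKconv hKi
  obtain ⟨C₂, hC₂, hO⟩ := RV.exists_sq_refFn_sub_le hK hKconv hKi
  obtain ⟨C₃, hC₃, hlin⟩ := exists_norm_lin_le hK hKi
  set κ : ℝ := volume.real K with hκ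
  have hκ0 : 0 ≤ κ := measureReal_nonneg
  -- `72` is `24` times three components; adding `1` ensures positivity without assumptions on `β`
  -- and `Λ`.
  refine ⟨72 * S ^ 2 * κ * (β ^ 2 * C₂ * C₃ ^ 2 + Λ ^ 2 * C₁) + 1, by positivity, ?_⟩
  intro Ω T n hΩ hvol hreg hT hnm hnb hna U G hG hGi
  have : IsFiniteMeasure (volume.restrict Ω) := ⟨by simpa using hvol.lt_top⟩
  set v : Pt d → Dir := T.dirFun RV U with hv
  have hvm : ∀ c, MemLp (fun y => v y c) ⊤ (volume.restrict Ω) :=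
    T.memLp_dirFun RV hK hKconv hKi hreg U
  have hvi : IntegrableOn (fun y => ‖v y‖ ^ 2) Ω := by
    simp only [EuclideanSpace.norm_sq_eq, Real.norm_eq_abs, sq_abs]
    refine integrable_finsetSum _ fun c _ => ?_
    simp only [sq]
    exact integrable_mul_of_memLp_top (hvm c) (hvm c)
  have hm : ∀ x : Pt d, ∃ m : Fin 3 → ℝ, x ∈ Ω → ∀ i, x ∈ T.cell i → ∀ c,
      ∀ᵐ y ∂volume.restrict (T.cell i), |n y c - m c| ≤ Λ * T.size := fun x => by
    by_cases hx : x ∈ Ω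
    · obtain ⟨m, h⟩ := hna x hx
      exact ⟨m, fun _ => h⟩
    · exact ⟨0, fun h => absurd h hx⟩
  choose m hm using hm
  -- The nodal interpolant of `2 n · v`, with `m x` standing in for the value of `n` at the node.
  set q : T.MulDof RQ → ℝ := fun x => ∑ c, 2 * (m x c * v x c) with hq
  refine ⟨q, ?_⟩
  simp only [sum_mul_inner_dirBasis]
  set e : Pt d → ℝ := fun y => 2 * ∑ c, n y c * v y c - ∑ j, q j * T.mulBasis RQ j y with he
  have hem : MemLp e ⊤ (volume.restrict Ω) := by
    have h1 : MemLp (fun y => ∑ c, n y c * v y c) ⊤ (volume.restrict Ω) :=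
      memLp_finsetSum _ fun c _ => MemLp.mul' (hvm c) (hnm c)
    exact (h1.const_mul 2).sub (T.memLp_mulFun RQ hK hKconv hKi hreg q)
  have hei : IntegrableOn (fun y => e y ^ 2) Ω := by
    simp only [sq]
    exact integrable_mul_of_memLp_top hem hem
  rw [T.integral_eq_sum_cell hK hKconv hKi hreg hei, T.integral_eq_sum_cell hK hKconv hKi hreg hvi,
    T.integral_eq_sum_cell hK hKconv hKi hreg hGi, ← Finset.sum_add_distrib, Finset.mul_sum]
  refine Finset.sum_le_sum fun i _ => ?_
  have hle := T.restrict_cell_le hK hKconv hKi hreg i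
  set w := fun c => T.dirRef RV U i c with hw
  set gr : Fin 3 → ℝ := fun c => ∫ y in K, ‖fderiv ℝ (RV.refFn (w c)) y‖ ^ 2 with hgr
  set ms : Fin 3 → ℝ := fun c => ∫ y in K, RV.refFn (w c) y ^ 2 with hms
  have hvcell : ∀ y ∈ T.cell i, ∀ c, v y c = RV.refFn (w c) ((T.map i).symm y) :=
    fun y hy c => T.dirFun_map RV hKconv hKi hT U i c hy
  have hpoint : ∀ᵐ y ∂volume.restrict (T.cell i), e y ^ 2 ≤
      24 * S ^ 2 * ∑ c, (β ^ 2 * (C₂ * gr c) + (Λ * T.size) ^ 2 * (C₁ * ms c)) := by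
    have hm' : ∀ a c, T.map i (RQ.node a) ∈ Ω → ∀ᵐ y ∂volume.restrict (T.cell i),
        |n y c - m (T.map i (RQ.node a)) c| ≤ Λ * T.size := fun a c h =>
      hm _ h i (T.map_node_mem_cell RQ i a) c
    have hm'' : ∀ᵐ y ∂volume.restrict (T.cell i), ∀ a c, T.map i (RQ.node a) ∈ Ω →
        |n y c - m (T.map i (RQ.node a)) c| ≤ Λ * T.size := by
      rw [ae_all_iff]
      intro a
      rw [ae_all_iff]
      intro c
      by_cases h : T.map i (RQ.node a) ∈ Ω
      · filter_upwards [hm' a c h] with y hy _ using hy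
      · exact Eventually.of_forall fun y h' => absurd h' h
    filter_upwards [hm'', T.ae_mem_interior_cell hKconv i,
      ae_mono hle (ae_all_iff.2 hnb)] with y hy1 hyi hyn
    have hyc := interior_subset hyi
    have hz := T.mem_cell_symm hyc
    have hQ : ∑ j, q j * T.mulBasis RQ j y =
        ∑ a, (∑ c, 2 * (m (T.map i (RQ.node a)) c * v (T.map i (RQ.node a)) c)) *
          RQ.shapeFn a ((T.map i).symm y) := by
      refine (T.sum_mul_basisFn_of_mem_interior RQ hKconv hKi q hyi).trans ?_
      refine Finset.sum_congr rfl fun a _ => ?_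
      rw [T.cellCoef_of_mem RQ q i a (T.map_node_mem_nodes RQ i a)]
    simp only [he]
    rw [hQ]
    have hnode : ∀ a c, v (T.map i (RQ.node a)) c = RV.refFn (w c) (RQ.node a) := fun a c => by
      rw [hvcell _ (T.map_node_mem_cell RQ i a), AffineEquiv.symm_apply_apply]
    refine sq_interpolation_error_le (hS _ hz) (RQ.sum_shapeFn _) hyn (fun a c h => ?_)
      (fun a c => ?_) fun a c => ?_
    -- A node where `v` has a nonzero component cannot lie on the frontier, so it lies in `Ω`, where
    -- `m` does approximate `n`.
    · refine hy1 a c ?_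
      by_contra hnot
      refine h (T.dirFun_frontier RV hT U ?_ c)
      rw [hΩ.frontier_eq]
      exact ⟨T.cell_subset_closure i (T.map_node_mem_cell RQ i a), hnot⟩
    · rw [hvcell y hyc, hnode]
      exact hO _ _ hz _ (RQ.node_mem a)
    · rw [hnode]
      exact hW _ _ (RQ.node_mem a)
  have hcellfin : volume (T.cell i) ≠ ⊤ := (T.isCompact_cell hK i).measure_lt_top.ne
  -- The pointwise bound is constant on the cell, so integration multiplies it by `jac i * κ`; this
  -- `jac i` is what turns the reference integrals `gr` and `ms` back into integrals over the cell.
  have hvolcell : volume.real (T.cell i) = T.jac i * κ := by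
    have := T.integral_cell hK i fun _ => 1
    simpa using this
  have hgrb : ∀ c, T.jac i * gr c ≤ (C₃ * T.size) ^ 2 * ∫ y in T.cell i, ‖G y‖ ^ 2 := fun c => by
    refine (T.jac_mul_integral_fderiv_le RV hK (w c) i).trans ?_
    have hl := hlin Ω T i
    refine mul_le_mul (pow_le_pow_left₀ (norm_nonneg _) hl 2) ?_
      (integral_nonneg fun y => sq_nonneg _) (sq_nonneg _)
    refine integral_mono_of_nonneg (Eventually.of_forall fun y => sq_nonneg _)
      (Integrable.mono_measure hGi hle) ?_
    filter_upwards [T.ae_fderiv_dirFun RV hKconv hKi hreg hT U hG i c] with y hy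
    refine hy.trans ?_
    rw [EuclideanSpace.norm_sq_eq, Fintype.sum_prod_type]
    simp only [Real.norm_eq_abs, sq_abs]
    exact Finset.single_le_sum (f := fun c => ∑ l, G y (c, l) ^ 2)
      (fun c _ => Finset.sum_nonneg fun l _ => sq_nonneg _) (Finset.mem_univ c)
  have hmsb : ∀ c, T.jac i * ms c ≤ ∫ y in T.cell i, ‖v y‖ ^ 2 := fun c => by
    have h1 : T.jac i * ms c = ∫ y in T.cell i, RV.refFn (w c) ((T.map i).symm y) ^ 2 := by
      rw [T.integral_cell hK]
      simp [hms]
    rw [h1]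
    refine integral_mono_of_nonneg (Eventually.of_forall fun y => sq_nonneg _)
      (Integrable.mono_measure hvi hle) ?_
    filter_upwards [ae_restrict_mem (T.isCompact_cell hK i).measurableSet] with y hy
    simp only [← hvcell y hy c]
    rw [← sq_abs, ← Real.norm_eq_abs]
    have := PiLp.norm_apply_le (v y) c
    gcongr
  set IG := ∫ y in T.cell i, ‖G y‖ ^ 2 with hIG
  set IV := ∫ y in T.cell i, ‖v y‖ ^ 2 with hIV
  have hIG0 : 0 ≤ IG := integral_nonneg fun y => sq_nonneg _
  have hIV0 : 0 ≤ IV := integral_nonneg fun y => sq_nonneg _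
  have hconst : IntegrableOn (fun _ : Pt d => 24 * S ^ 2 *
      ∑ c, (β ^ 2 * (C₂ * gr c) + (Λ * T.size) ^ 2 * (C₁ * ms c))) (T.cell i) :=
    integrableOn_const hcellfin
  calc ∫ y in T.cell i, e y ^ 2
      ≤ ∫ y in T.cell i, 24 * S ^ 2 *
          ∑ c, (β ^ 2 * (C₂ * gr c) + (Λ * T.size) ^ 2 * (C₁ * ms c)) :=
        integral_mono_of_nonneg (Eventually.of_forall fun y => sq_nonneg _)
          hconst hpoint
    _ = 24 * S ^ 2 * κ *
          ∑ c, (β ^ 2 * C₂ * (T.jac i * gr c) + (Λ * T.size) ^ 2 * C₁ * (T.jac i * ms c)) := by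
        rw [setIntegral_const, hvolcell, smul_eq_mul, Finset.mul_sum, Finset.mul_sum,
          Finset.mul_sum]
        exact Finset.sum_congr rfl fun c _ => by ring
    _ ≤ 24 * S ^ 2 * κ *
          ∑ _c : Fin 3, (β ^ 2 * C₂ * ((C₃ * T.size) ^ 2 * IG) + (Λ * T.size) ^ 2 * C₁ * IV) := by
        refine mul_le_mul_of_nonneg_left (Finset.sum_le_sum fun c _ => ?_) (by positivity)
        exact add_le_add (mul_le_mul_of_nonneg_left (hgrb c) (by positivity))
          (mul_le_mul_of_nonneg_left (hmsb c) (by positivity))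
    _ = 72 * S ^ 2 * κ * T.size ^ 2 * (β ^ 2 * C₂ * C₃ ^ 2 * IG + Λ ^ 2 * C₁ * IV) := by
        simp only [Finset.sum_const, Finset.card_univ, Fintype.card_fin, nsmul_eq_mul]
        push_cast
        ring
    _ ≤ 72 * S ^ 2 * κ * T.size ^ 2 * ((β ^ 2 * C₂ * C₃ ^ 2 + Λ ^ 2 * C₁) * (IV + IG)) := by
        gcongr
        have h1 : 0 ≤ β ^ 2 * C₂ * C₃ ^ 2 * IV := by positivity
        have h2 : 0 ≤ Λ ^ 2 * C₁ * IG := by positivity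
        linarith
    _ ≤ _ := by
        have : 0 ≤ T.size ^ 2 * (IV + IG) := by positivity
        linarith

/-! ### The defect estimate and its limit -/

open AffineMesh

/-- The defect estimate in terms of a square integrable weak gradient. -/
theorem exists_sq_norm_defect_le {d : ℕ} (hd : 0 < d) {K : Set (Pt d)} (hK : IsCompact K)
    (hKconv : Convex ℝ K) (hKi : (interior K).Nonempty) (RV RQ : LagrangeElement K)
    {β : ℝ} (hβ : 1 ≤ β) (L : ℝ) :
    ∃ C : ℝ, 0 < C ∧ ∀ Ω : Set (Pt d), IsOpen Ω → Bornology.IsBounded Ω →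
      interior (closure Ω) = Ω →
      ∀ (n : Pt d → Dir) (Gn : Pt d → EuclideanSpace ℝ (Fin 3 × Fin d)),
      IsWeakGradient Ω n Gn → (∀ᵐ x ∂volume.restrict Ω, ‖n x‖ ^ 2 ≤ β) →
      (∀ᵐ x ∂volume.restrict Ω, ‖Gn x‖ ≤ L) →
      ∀ T : AffineMesh K Ω, T.IsConforming RV → ∀ (U : T.DirDof RV → ℝ)
        (G : Pt d → EuclideanSpace ℝ (Fin 3 × Fin d)),
      IsWeakGradient Ω (T.dirFun RV U) G → IntegrableOn (fun y => ‖G y‖ ^ 2) Ω →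
      ‖WithLp.toLp 2 (T.defectMatrix RV RQ n *ᵥ U)‖ ^ 2 ≤
        C * T.size ^ (d + 2) * ((∫ y in Ω, ‖T.dirFun RV U y‖ ^ 2) + ∫ y in Ω, ‖G y‖ ^ 2) := by
  classical
  obtain ⟨S, hS0, hS⟩ := RV.exists_sum_abs_shapeFn_le hK
  obtain ⟨C, hC, hint⟩ :=
    exists_interpolation_error_le hK hKconv hKi RV RQ β (3 * d * |L|)
  set vb : ℝ := volume.real (Metric.ball (0 : Pt d) 1) with hvb
  have hvb0 : 0 ≤ vb := measureReal_nonneg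
  refine ⟨12 * β ^ 2 * S ^ 2 * vb * C + 1, by positivity, ?_⟩
  intro Ω hΩ hb hreg n Gn hn hnβ hGn T hT U G hG hGi
  have hvol : volume Ω ≠ ⊤ := hb.measure_lt_top.ne
  have : IsFiniteMeasure (volume.restrict Ω) := ⟨by simpa using hvol.lt_top⟩
  -- `β ≥ 1` permits replacing `√β` by `β`.
  have hnn : ∀ᵐ x ∂volume.restrict Ω, ‖n x‖ ≤ β := by
    filter_upwards [hnβ] with x hx
    nlinarith [norm_nonneg (n x)]
  have hnb : ∀ c, ∀ᵐ x ∂volume.restrict Ω, |n x c| ≤ β := fun c => by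
    filter_upwards [hnn] with x hx
    exact (PiLp.norm_apply_le (n x) c).trans hx
  have hnm : ∀ c, MemLp (fun y => n y c) ⊤ (volume.restrict Ω) := fun c => by
    refine memLp_top_of_bound ?_ β (hnb c)
    exact (EuclideanSpace.proj c : Dir →L[ℝ] ℝ).continuous.comp_aestronglyMeasurable
      hn.locallyIntegrable.aestronglyMeasurable
  have hGb : ∀ c l, ∀ᵐ x ∂volume.restrict Ω, |Gn x (c, l)| ≤ |L| := fun c l => by
    filter_upwards [hGn] with x hx
    exact (PiLp.norm_apply_le (Gn x) (c, l)).trans (hx.trans (le_abs_self L))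
  have hna : ∀ x ∈ Ω, ∃ m : Fin 3 → ℝ, ∀ i, x ∈ T.cell i → ∀ c,
      ∀ᵐ y ∂volume.restrict (T.cell i), |n y c - m c| ≤ 3 * d * |L| * T.size := by
    intro x hx
    rcases isEmpty_or_nonempty (Fin T.num) with he | ⟨⟨i₀⟩⟩
    · exact ⟨0, fun i => isEmptyElim i⟩
    · have := fun c => T.exists_approx_value hK hKconv hKi hreg hΩ (abs_nonneg L)
        ((hnm c).integrable le_top) (hGb c) (hn.hasWeakPartials c) (T.size_pos hd hK hKi i₀) hx
      choose m hm using this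
      exact ⟨m, fun i hi c => hm c i hi⟩
  obtain ⟨q, hq⟩ := hint Ω T n hΩ hvol hreg hT hnm hnb hna U G hG hGi
  have hψm : ∀ k, MemLp (fun y => inner ℝ (n y) (T.dirBasis RV k y)) ⊤ (volume.restrict Ω) := by
    intro k
    simp only [inner_dirBasis]
    exact MemLp.mul' (hnm k.2) (T.memLp_basisFn RV hK hKconv hKi hreg k.1)
  have hbm : ∀ j, MemLp (T.mulBasis RQ j) ⊤ (volume.restrict Ω) := fun j =>
    T.memLp_basisFn RQ hK hKconv hKi hreg j
  obtain ⟨p, hp, hmin⟩ := exists_projection_residual (A := T.augMatrix RV n)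
    (B := T.constraintMatrix RV RQ n) (M := T.massMatrix RQ) hbm hψm
    (T.eq_zero_of_integral_sq_eq_zero RQ hK hKconv hKi hreg hvol)
    (fun k l => rfl) (fun j k => rfl) (fun i j => rfl) U
  -- The two sides may carry different decidable equality instances inside the matrix inverse.
  have hdefect : T.defectMatrix RV RQ n = T.augMatrix RV n -
      (T.constraintMatrix RV RQ n)ᵀ * (T.massMatrix RQ)⁻¹ * T.constraintMatrix RV RQ n := by
    unfold defectMatrix
    congr
  rw [← hdefect] at hp
  set e : Pt d → ℝ := fun y => 2 * ∑ k, U k * inner ℝ (n y) (T.dirBasis RV k y) -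
    ∑ j, p j * T.mulBasis RQ j y with he
  have hem : MemLp e ⊤ (volume.restrict Ω) := by
    have h1 : MemLp (fun y => ∑ k, U k * inner ℝ (n y) (T.dirBasis RV k y)) ⊤
        (volume.restrict Ω) := memLp_finsetSum _ fun k _ => (hψm k).const_mul (U k)
    exact (h1.const_mul 2).sub (T.memLp_mulFun RQ hK hKconv hKi hreg p)
  have hψb : ∀ k : T.DirDof RV, ∀ᵐ y ∂volume.restrict Ω,
      |(inner ℝ (n y) (T.dirBasis RV k y) : ℝ)| ≤ β * |T.basisFn RV k.1 y| := by
    intro k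
    filter_upwards [hnb k.2] with y hy
    rw [inner_dirBasis, abs_mul, mul_comm]
    exact mul_le_mul_of_nonneg_right hy (abs_nonneg _)
  have hsize := T.size_nonneg
  have hsum := sum_sq_integral_le (X := ↥(T.interiorNodes RV)) (C := Fin 3)
    (b := fun x => T.basisFn RV x) (fun x => T.memLp_basisFn RV hK hKconv hKi hreg x) hem
    (γ := β) (V := S * vb * T.size ^ d) (S := S) (by positivity) hψb
    (fun x => T.integral_abs_basisFn_le RV hK hS0.le hS x)
    (fun y => T.sum_abs_basisFn_le RV hS0.le hS _ y)
  set H := (∫ y in Ω, ‖T.dirFun RV U y‖ ^ 2) + ∫ y in Ω, ‖G y‖ ^ 2 with hH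
  have hH0 : 0 ≤ H :=
    add_nonneg (integral_nonneg fun y => sq_nonneg _) (integral_nonneg fun y => sq_nonneg _)
  calc ‖WithLp.toLp 2 (T.defectMatrix RV RQ n *ᵥ U)‖ ^ 2
      = ∑ k, (2 * ∫ y in Ω, e y * inner ℝ (n y) (T.dirBasis RV k y)) ^ 2 := by
        rw [EuclideanSpace.norm_sq_eq]
        refine Finset.sum_congr rfl fun k _ => ?_
        rw [Real.norm_eq_abs, sq_abs]
        exact congrArg (· ^ 2) (hp k)
    _ ≤ _ := hsum
    _ ≤ 4 * β ^ 2 * (Fintype.card (Fin 3) : ℝ) * (S * vb * T.size ^ d) * S *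
          (C * T.size ^ 2 * H) :=
        mul_le_mul_of_nonneg_left ((hmin q).trans hq) (by positivity)
    _ = 12 * β ^ 2 * S ^ 2 * vb * C * (T.size ^ (d + 2) * H) := by
        rw [Fintype.card_fin]
        push_cast
        ring
    _ ≤ _ := by
        have : 0 ≤ T.size ^ (d + 2) * H := by positivity
        linarith

/-- The defect estimate in terms of the `H¹` norm. -/
theorem exists_norm_defect_le {d : ℕ} (hd : 0 < d) {K : Set (Pt d)} (hK : IsCompact K)
    (hKconv : Convex ℝ K) (hKi : (interior K).Nonempty) (RV RQ : LagrangeElement K)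
    {β : ℝ} (hβ : 1 ≤ β) (L : ℝ) :
    ∃ C : ℝ, 0 < C ∧ ∀ Ω : Set (Pt d), IsOpen Ω → Bornology.IsBounded Ω →
      interior (closure Ω) = Ω →
      ∀ (n : Pt d → Dir) (Gn : Pt d → EuclideanSpace ℝ (Fin 3 × Fin d)),
      IsWeakGradient Ω n Gn → (∀ᵐ x ∂volume.restrict Ω, ‖n x‖ ^ 2 ≤ β) →
      (∀ᵐ x ∂volume.restrict Ω, ‖Gn x‖ ≤ L) →
      ∀ T : AffineMesh K Ω, T.IsConforming RV → ∀ U : T.DirDof RV → ℝ,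
      ENNReal.ofReal ‖WithLp.toLp 2 (T.defectMatrix RV RQ n *ᵥ U)‖ ≤
        ENNReal.ofReal (C * T.size ^ (1 + (d : ℝ) / 2)) * h1Norm Ω (T.dirFun RV U) := by
  obtain ⟨C, hC, hmain⟩ := exists_sq_norm_defect_le hd hK hKconv hKi RV RQ hβ L
  refine ⟨√C, Real.sqrt_pos.2 hC, ?_⟩
  intro Ω hΩ hb hreg n Gn hn hnβ hGn T hT U
  classical
  -- A mesh without cells has no degrees of freedom. Otherwise the mesh size is positive, so the
  -- prefactor `a` is nonzero, as needed to move it inside the infimum and to multiply it with `∞`.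
  rcases isEmpty_or_nonempty (Fin T.num) with hemp | ⟨⟨i₀⟩⟩
  · have h0 : IsEmpty (T.DirDof RV) := by
      refine ⟨fun k => ?_⟩
      obtain ⟨⟨i, a⟩, -, -⟩ := Finset.mem_image.1 (Finset.mem_filter.1 k.1.2).1
      exact isEmptyElim i
    rw [Subsingleton.elim (WithLp.toLp 2 (T.defectMatrix RV RQ n *ᵥ U)) 0, norm_zero]
    simp
  have hs : 0 < T.size := T.size_pos hd hK hKi i₀
  set a : ℝ := √C * T.size ^ (1 + (d : ℝ) / 2) with ha
  have ha0 : 0 < a := by positivity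
  have ha2 : a ^ 2 = C * T.size ^ (d + 2) := by
    rw [ha, mul_pow, Real.sq_sqrt hC.le, ← Real.rpow_natCast (T.size ^ _) 2, ← Real.rpow_mul hs.le,
      ← Real.rpow_natCast T.size]
    congr 2
    push_cast
    ring
  have hvm := T.memLp_dirFun RV hK hKconv hKi hreg U
  have hvol : volume Ω ≠ ⊤ := hb.measure_lt_top.ne
  have : IsFiniteMeasure (volume.restrict Ω) := ⟨by simpa using hvol.lt_top⟩
  have hvi : IntegrableOn (fun y => ‖T.dirFun RV U y‖ ^ 2) Ω := by
    simp only [EuclideanSpace.norm_sq_eq, Real.norm_eq_abs, sq_abs]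
    refine integrable_finsetSum _ fun c _ => ?_
    simp only [sq]
    exact integrable_mul_of_memLp_top (hvm c) (hvm c)
  have hcoe : ∀ {E : Type} [NormedAddCommGroup E] (x : E),
      ‖x‖ₑ ^ 2 = ENNReal.ofReal (‖x‖ ^ 2) := fun x => by
    rw [ENNReal.ofReal_pow (norm_nonneg _), ofReal_norm]
  rw [h1Norm]
  simp only [ENNReal.mul_iInf_of_ne (ENNReal.ofReal_pos.2 ha0).ne' ENNReal.ofReal_ne_top]
  refine le_iInf fun G => le_iInf fun hG => ?_
  -- A weak gradient that is not square integrable makes the right-hand side infinite; for the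
  -- others the real-valued estimate applies.
  by_cases htop : ∫⁻ y in Ω, ‖G y‖ₑ ^ 2 = ⊤
  · rw [htop, add_top, ENNReal.top_rpow_of_pos (by norm_num),
      ENNReal.mul_top (ENNReal.ofReal_pos.2 ha0).ne']
    exact le_top
  have hGm : AEStronglyMeasurable G (volume.restrict Ω) :=
    hG.locallyIntegrable_grad.aestronglyMeasurable
  have hGi : IntegrableOn (fun y => ‖G y‖ ^ 2) Ω := by
    refine ⟨hGm.norm.pow 2, ?_⟩
    rw [hasFiniteIntegral_iff_ofReal (Eventually.of_forall fun y => sq_nonneg _)]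
    simp only [← hcoe]
    exact lt_top_iff_ne_top.2 htop
  have h := hmain Ω hΩ hb hreg n Gn hn hnβ hGn T hT U G hG hGi
  have e1 : ∫⁻ y in Ω, ‖T.dirFun RV U y‖ₑ ^ 2 =
      ENNReal.ofReal (∫ y in Ω, ‖T.dirFun RV U y‖ ^ 2) := by
    simp only [hcoe]
    exact (ofReal_integral_eq_lintegral_ofReal hvi
      (Eventually.of_forall fun y => sq_nonneg _)).symm
  have e2 : ∫⁻ y in Ω, ‖G y‖ₑ ^ 2 = ENNReal.ofReal (∫ y in Ω, ‖G y‖ ^ 2) := by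
    simp only [hcoe]
    exact (ofReal_integral_eq_lintegral_ofReal hGi
      (Eventually.of_forall fun y => sq_nonneg _)).symm
  have p1 : 0 ≤ ∫ y in Ω, ‖T.dirFun RV U y‖ ^ 2 := integral_nonneg fun y => sq_nonneg _
  have p2 : 0 ≤ ∫ y in Ω, ‖G y‖ ^ 2 := integral_nonneg fun y => sq_nonneg _
  rw [e1, e2, ← ENNReal.ofReal_add p1 p2,
    ENNReal.ofReal_rpow_of_nonneg (add_nonneg p1 p2) (by norm_num),
    ← ENNReal.ofReal_mul ha0.le, ← Real.sqrt_eq_rpow]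
  refine ENNReal.ofReal_le_ofReal (abs_le_of_sq_le_sq' ?_ (by positivity)).2
  rw [mul_pow, Real.sq_sqrt (add_nonneg p1 p2), ha2]
  exact h

end OseenFrank

end

theorem theorem3p1 {d : ℕ} (hd : d = 2 ∨ d = 3)
    -- reference cell, director element and multiplier element
    (K : Set (OseenFrank.Pt d)) (hKc : IsCompact K) (hKconv : Convex ℝ K)
    (hKi : (interior K).Nonempty)
    (RV RQ : OseenFrank.LagrangeElement K)
    -- bounds for the current approximation of the director
    (α β L : ℝ) (hα : 0 < α) (hα1 : α ≤ 1) (hβ : 1 ≤ β) :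
    ∃ C : ℝ, 0 < C ∧
      ∀ Ω : Set (OseenFrank.Pt d), IsOpen Ω → Bornology.IsBounded Ω → interior (closure Ω) = Ω →
      ∀ (n : OseenFrank.Pt d → OseenFrank.Dir)
        (Gn : OseenFrank.Pt d → EuclideanSpace ℝ (Fin 3 × Fin d)),
        OseenFrank.IsWeakGradient Ω n Gn →
        (∀ᵐ x ∂(volume.restrict Ω), α ≤ ‖n x‖ ^ 2 ∧ ‖n x‖ ^ 2 ≤ β) →
        (∀ᵐ x ∂(volume.restrict Ω), ‖Gn x‖ ≤ L) →
        -- the estimate, with `C` independent of the mesh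
        (∀ T : OseenFrank.AffineMesh K Ω, T.IsConforming RV → ∀ U : T.DirDof RV → ℝ,
          ENNReal.ofReal ‖WithLp.toLp 2 (T.defectMatrix RV RQ n *ᵥ U)‖ ≤
            ENNReal.ofReal (C * T.size ^ (1 + (d : ℝ) / 2)) *
              OseenFrank.h1Norm Ω (T.dirFun RV U)) ∧
        -- the difference vanishes as the mesh size tends to zero
        (∀ T : ℕ → OseenFrank.AffineMesh K Ω, (∀ j, (T j).IsConforming RV) →
          Tendsto (fun j => (T j).size) atTop (𝓝 0) →
          ∀ U : (j : ℕ) → (T j).DirDof RV → ℝ,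
          (∃ M : ℝ≥0, ∀ j, OseenFrank.h1Norm Ω ((T j).dirFun RV (U j)) ≤ M) →
          Tendsto (fun j => ‖WithLp.toLp 2 ((T j).defectMatrix RV RQ n *ᵥ U j)‖)
            atTop (𝓝 0)) := by 
  have hd0 : 0 < d := by omega
  obtain ⟨C, hC, hmain⟩ :=
    OseenFrank.exists_norm_defect_le hd0 hKc hKconv hKi RV RQ hβ L
  refine ⟨C, hC, fun Ω hΩ hb hreg n Gn hn hnb hGn => ?_⟩
  have hest := hmain Ω hΩ hb hreg n Gn hn (hnb.mono fun x hx => hx.2) hGn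
  refine ⟨hest, fun T hT hsize U ⟨M, hM⟩ => ?_⟩
  have hlim : Tendsto (fun j => C * (T j).size ^ (1 + (d : ℝ) / 2) * M) atTop (𝓝 0) := by
    have hpos : 0 < 1 + (d : ℝ) / 2 := by positivity
    have h1 := (hsize.rpow_const (Or.inr hpos.le)).const_mul C |>.mul_const (M : ℝ)
    rwa [Real.zero_rpow hpos.ne', mul_zero, zero_mul] at h1
  refine squeeze_zero (fun j => norm_nonneg _) (fun j => ?_) hlim
  have hs := (T j).size_nonneg
  have h1 := (hest (T j) (hT j) (U j)).trans (mul_le_mul_right (hM j) _)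
  rw [← ENNReal.ofReal_coe_nnreal, ← ENNReal.ofReal_mul (by positivity)] at h1
  exact (ENNReal.ofReal_le_ofReal_iff (by positivity)).1 h1
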